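/- Let $M$ be a smooth manifold of dimension $2\ell$ endowed with a conformal structure $c$, i.e. a class of smooth Riemannian metrics modulo the relation $g\sim e^{2\varphi}g$, $\varphi\in C^\infty(M)$. Let $I(T(M))\subset \mathrm{End}(T(M))$ be the bundle whose fibre over $x$ is the set of $J\in\mathrm{End}(T_xM)$ with $J^2=-1$, and let $H(T(M))\subset I(T(M))$ be the subset of those $J\in I(T(M))$, $J\in\mathrm{End}(T_xM)$, with $g_x(JX,JY)=g_x(X,Y)$ for all $X,Y\in T_xM$, for some metric $g$ in $c$. A linear connection $\nabla$ on $M$ splits the tangent space of $\mathrm{End}(T(M))$ at $J\in \mathrm{End}(T_xM)$ into horizontal vectors, identified with $T_xM$ by horizontal lift, and vertical vectors, identified with $\mathrm{End}(T_xM)$. The natural almost complex structure $j^\nabla$ of $I(T(M))$ is the restriction to the tangent spaces of $I(T(M))$, at points $J\in I(T(M))$, of the endomorphism which on horizontal vectors is the horizontal lift of $X\mapsto JX$ and on vertical vectors is $A\mapsto JA$ (the vertical vectors tangent to $I(T(M))$ at $J$ being the $A$ with $AJ+JA=0$). Then: (1) If $g$ and $g'$ are two Riemannian metrics in $c$, with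 Levi-Civita connections $\nabla$ and $\nabla'$, then $j^{\nabla}$ and $j^{\nabla'}$ coincide on the tangent space of $I(T(M))$ at $J$, for every $J\in H(T(M))$. (2) Hence $H(T(M))$, which is an embedded smooth submanifold of $\mathrm{End}(T(M))$, carries an almost complex structure that depends only on the conformal structure $c$: there is exactly one (smooth) almost complex structure $j$ on $H(T(M))$ such that, for every metric $g$ in $c$ with Levi-Civita connection $\nabla$, $j$ is the restriction of $j^\nabla$ to the tangent spaces of $H(T(M))$. -/

import Mathlib

open Bundle Manifold ContDiff

noncomputable section

namespace ConformalTwistor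

/-! ### Submanifolds of a manifold and almost complex structures on them -/

section Submanifold

variable {W : Type*} [NormedAddCommGroup W] [NormedSpace ℝ W]
  {HN : Type*} [TopologicalSpace HN] (IN : ModelWithCorners ℝ W HN)
  {N : Type*} [TopologicalSpace N] [ChartedSpace HN N]

/-- `S` is an embedded smooth submanifold of the manifold `N` (without boundary): around each of
its points there is a smooth diffeomorphism from an open set of `N` onto an open set of the model
vector space that maps `S` onto the trace of a vector subspace. -/
def IsEmbeddedSubmanifold (S : Set N) : Prop :=
  ∀ p ∈ S, ∃ (F : Submodule ℝ W) (φ : OpenPartialHomeomorph N W),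
    p ∈ φ.source ∧
    ContMDiffOn IN 𝓘(ℝ, W) ∞ φ φ.source ∧
    ContMDiffOn 𝓘(ℝ, W) IN ∞ φ.symm φ.target ∧
    ∀ q ∈ φ.source, q ∈ S ↔ φ q ∈ F

/-- The tangent space at `p` of a submanifold `S` of `N`, as a subspace of the tangent space of `N`
at `p`: it is spanned by the velocities at time `0` of the smooth curves in `S` that pass through
`p` at time `0`. -/
def tangentSubspace (S : Set N) (p : N) : Submodule ℝ (TangentSpace IN p) :=
  Submodule.span ℝ {v | ∃ ε > 0, ∃ γ : ℝ → N,
    ContMDiffOn 𝓘(ℝ, ℝ) IN ∞ γ (Set.Ioo (-ε) ε) ∧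
    (∀ t ∈ Set.Ioo (-ε) ε, γ t ∈ S) ∧
    (⟨γ 0, mfderiv 𝓘(ℝ, ℝ) IN γ 0 (1 : ℝ)⟩ : TangentBundle IN N) = ⟨p, v⟩}

/-- An almost complex structure on a submanifold `S` of `N`: a smooth field of endomorphisms of the
tangent spaces of `S` with square minus the identity. Smoothness on a submanifold means, as usual,
that the field is locally the restriction of a smooth field of endomorphisms of the tangent spaces
of `N`. -/
structure AlmostComplexStructureOn [IsManifold IN ∞ N] (S : Set N) where
  /-- The endomorphism of the tangent space at each point of `S`. -/
  toFun : ∀ p : S, tangentSubspace IN S (p : N) →ₗ[ℝ] tangentSubspace IN S (p : N)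
  sq_eq_neg : ∀ (p : S) (v : tangentSubspace IN S (p : N)), toFun p (toFun p v) = -v
  smooth : ∀ p : S, ∃ U : Set N, IsOpen U ∧ (p : N) ∈ U ∧
    ∃ Φ : ∀ q : N, TangentSpace IN q →L[ℝ] TangentSpace IN q,
      ContMDiffOn IN (IN.prod 𝓘(ℝ, W →L[ℝ] W)) ∞
        (fun q => TotalSpace.mk' (W →L[ℝ] W)
          (E := fun q : N => TangentSpace IN q →L[ℝ] TangentSpace IN q) q (Φ q)) U ∧
      ∀ q : S, (q : N) ∈ U → ∀ v : tangentSubspace IN S (q : N),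
        Φ q v = (toFun q v : TangentSpace IN (q : N))

end Submanifold

variable {E : Type*} [NormedAddCommGroup E] [NormedSpace ℝ E]
  {M : Type*} [TopologicalSpace M] [ChartedSpace E M]

/-! ### The bundle of endomorphisms of the tangent spaces -/

/-- The space of endomorphisms of the tangent space of `M` at `x`. -/
abbrev EndFiber (E : Type*) [NormedAddCommGroup E] [NormedSpace ℝ E]
    {M : Type*} [TopologicalSpace M] [ChartedSpace E M] (x : M) : Type _ :=
  TangentSpace 𝓘(ℝ, E) x →L[ℝ] TangentSpace 𝓘(ℝ, E) x

variable [IsManifold 𝓘(ℝ, E) ∞ M]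

variable (E M) in
/-- The total space of the smooth vector bundle `End(TM)`; its points are the pairs `⟨x, A⟩` with
`x` in `M` and `A` an endomorphism of the tangent space at `x`. -/
abbrev EndBundle := TotalSpace (E →L[ℝ] E) (fun x : M => EndFiber E x)

variable (E) in
/-- The model with corners of the manifold `End(TM)`. -/
abbrev endModel := 𝓘(ℝ, E).prod 𝓘(ℝ, E →L[ℝ] E)

variable (E M) in
/-- The bundle `I(TM)` of complex structures over `M`, as a subset of `End(TM)`: the pairs `⟨x, J⟩`
where `J` is an endomorphism of the tangent space at `x` with square minus the identity. -/
def complexStructures : Set (EndBundle E M) :=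
  {J | ∀ X : TangentSpace 𝓘(ℝ, E) J.1, J.2 (J.2 X) = -X}

/-! ### Metrics and conformal structures -/

variable (E M) in
/-- Smooth Riemannian metrics on `M`. -/
abbrev RiemMetric := ContMDiffRiemannianMetric 𝓘(ℝ, E) ∞ E (fun x : M => TangentSpace 𝓘(ℝ, E) x)

/-- Two metrics are conformally related if `g' = exp(2 φ) g` for a smooth function `φ`. -/
def ConformallyRelated (g g' : RiemMetric E M) : Prop :=
  ∃ φ : M → ℝ, ContMDiff 𝓘(ℝ, E) 𝓘(ℝ, ℝ) ∞ φ ∧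
    ∀ (x : M) (X Y : TangentSpace 𝓘(ℝ, E) x),
      g'.inner x X Y = Real.exp (2 * φ x) * g.inner x X Y

theorem conformallyRelated_equivalence :
    Equivalence (ConformallyRelated : RiemMetric E M → RiemMetric E M → Prop) where
  refl g := ⟨fun _ => 0, contMDiff_const, fun x X Y => by simp⟩
  symm := by
    rintro g g' ⟨φ, hφ, h⟩
    refine ⟨fun x => -φ x, hφ.neg, fun x X Y => ?_⟩
    rw [h, ← mul_assoc, ← Real.exp_add]
    simp
  trans := by
    rintro g g' g'' ⟨φ, hφ, h⟩ ⟨ψ, hψ, h'⟩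
    refine ⟨fun x => ψ x + φ x, hψ.add hφ, fun x X Y => ?_⟩
    rw [h', h, ← mul_assoc, ← Real.exp_add, mul_add]

variable (E M) in
/-- A conformal structure on `M`: a conformal class of Riemannian metrics. -/
def ConformalStructure :=
  Quotient (⟨ConformallyRelated, conformallyRelated_equivalence⟩ : Setoid (RiemMetric E M))

/-- The conformal structure induced by a metric. -/
def RiemMetric.conformalStructure (g : RiemMetric E M) : ConformalStructure E M :=
  Quotient.mk _ g

/-- The metric `g` is compatible with (i.e. induces) the conformal structure `c`. -/
def ConformalStructure.IsCompatible (c : ConformalStructure E M) (g : RiemMetric E M) : Prop :=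
  RiemMetric.conformalStructure g = c

/-- The bundle `H(TM)` of complex structures over `M` compatible with the conformal structure `c`:
the complex structures on tangent spaces that are isometric for a metric inducing `c`. -/
def isometricComplexStructures (c : ConformalStructure E M) : Set (EndBundle E M) :=
  {J | J ∈ complexStructures E M ∧ ∃ g : RiemMetric E M, c.IsCompatible g ∧
    ∀ X Y : TangentSpace 𝓘(ℝ, E) J.1, g.inner J.1 (J.2 X) (J.2 Y) = g.inner J.1 X Y}

/-! ### Linear connections and the splitting of the tangent bundle of `End(TM)` -/

variable (E M) in
/-- Linear connections on `M`, as covariant derivatives on the tangent bundle. For a vector field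
`Y` and a tangent vector `X` at `x`, the vector usually written `∇_X Y` is `D Y x X`. -/
abbrev LinearConnection :=
  CovariantDerivative 𝓘(ℝ, E) E (fun x : M => TangentSpace 𝓘(ℝ, E) x)

theorem endDeriv_tensorial (D : LinearConnection E M) (s : Π x : M, EndFiber E x) (x : M)
    (hs : MDifferentiableAt 𝓘(ℝ, E) (endModel E) (fun y => (⟨y, s y⟩ : EndBundle E M)) x)
    (X : TangentSpace 𝓘(ℝ, E) x) :
    TensorialAt 𝓘(ℝ, E) E (V := fun x : M => TangentSpace 𝓘(ℝ, E) x)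
      (fun Y : Π x : M, TangentSpace 𝓘(ℝ, E) x =>
        D (fun y => s y (Y y)) x X - s x (D Y x X)) x where
  smul {f Y} hf hY := by
    have h1 := D.isCovariantDerivativeOn.leibniz (MDifferentiableAt.clm_bundle_apply hs hY) hf
    have h2 := D.isCovariantDerivativeOn.leibniz hY hf
    have h3 : (fun y => s y ((f • Y) y)) = f • (fun y => s y (Y y)) := by
      ext y; simp
    rw [h3, h1, h2]
    simp
    module
  add {Y Z} hY hZ := by
    have h1 := D.isCovariantDerivativeOn.add (MDifferentiableAt.clm_bundle_apply hs hY)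
      (MDifferentiableAt.clm_bundle_apply hs hZ)
    have h2 := D.isCovariantDerivativeOn.add hY hZ
    have h3 : (fun y => s y ((Y + Z) y)) = (fun y => s y (Y y)) + (fun y => s y (Z y)) := by
      ext y; simp
    rw [h3, h1, h2]
    simp
    abel

/-- A smooth local section of `End(TM)` through the point `J` (it is constant in the preferred
trivialization around the base point of `J`). -/
def sectionThrough (J : EndBundle E M) (y : M) : EndFiber E y :=
  FiberBundle.extend (E →L[ℝ] E) (E := fun y : M => EndFiber E y) J.2 y

theorem sectionThrough_self (J : EndBundle E M) :
    (⟨J.1, sectionThrough J J.1⟩ : EndBundle E M) = J := by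
  simp [sectionThrough]

theorem sectionThrough_mdifferentiableAt (J : EndBundle E M) :
    MDifferentiableAt 𝓘(ℝ, E) (endModel E)
      (fun y => (⟨y, sectionThrough J y⟩ : EndBundle E M)) J.1 :=
  FiberBundle.mdifferentiableAt_extend 𝓘(ℝ, E) (E →L[ℝ] E) (V := fun y : M => EndFiber E y) J.2

/-- The velocity of `sectionThrough J` at the base point of `J`, as a map into the tangent space of
`End(TM)` at `J` (by `sectionThrough_self` the section takes the value `J` there). -/
def sectionThroughDeriv (J : EndBundle E M) :
    TangentSpace 𝓘(ℝ, E) J.1 →L[ℝ] TangentSpace (endModel E) J :=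
  mfderiv 𝓘(ℝ, E) (endModel E) (fun y : M => (⟨y, sectionThrough J y⟩ : EndBundle E M)) J.1

/-- The identification of the endomorphisms of the tangent space of `M` at `x` with the vertical
vectors at `J`, for `J` over `x`, i.e. the derivative at `J` of the inclusion of the fiber in `End(TM)`. -/
def verticalLift (J : EndBundle E M) :
    EndFiber E J.1 →L[ℝ] TangentSpace (endModel E) J :=
  mfderiv 𝓘(ℝ, E →L[ℝ] E) (endModel E) (fun A : E →L[ℝ] E => (⟨J.1, A⟩ : EndBundle E M)) J.2

theorem contMDiff_fiber_inclusion (x : M) :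
    ContMDiff 𝓘(ℝ, E →L[ℝ] E) (endModel E) ∞
      (fun A : E →L[ℝ] E => (⟨x, A⟩ : EndBundle E M)) := by
  intro A
  rw [contMDiffAt_totalSpace]
  refine ⟨contMDiffAt_const, ?_⟩
  have h : (fun A : E →L[ℝ] E =>
      (trivializationAt (E →L[ℝ] E) (fun x : M => EndFiber E x) x ⟨x, A⟩).2) =
      (Bundle.Trivialization.continuousLinearEquivAt ℝ
        (trivializationAt (E →L[ℝ] E) (fun x : M => EndFiber E x) x) x
        (FiberBundle.mem_baseSet_trivializationAt' x) : EndFiber E x →L[ℝ] (E →L[ℝ] E)) := by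
    ext A; rfl
  change ContMDiffAt _ _ _ (fun A : E →L[ℝ] E =>
      (trivializationAt (E →L[ℝ] E) (fun x : M => EndFiber E x) x ⟨x, A⟩).2) A
  rw [h]
  exact (ContinuousLinearMap.contDiff (𝕜 := ℝ) (E := E →L[ℝ] E) (F := E →L[ℝ] E) _).contMDiff A

theorem hasMFDerivAt_fiber_inclusion (J : EndBundle E M) :
    HasMFDerivAt 𝓘(ℝ, E →L[ℝ] E) (endModel E)
      (fun A : E →L[ℝ] E => (⟨J.1, A⟩ : EndBundle E M)) J.2 (verticalLift J) :=
  ((contMDiff_fiber_inclusion (E := E) J.1).mdifferentiable (by simp) _).hasMFDerivAt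

theorem verticalLift_injective (J : EndBundle E M) : Function.Injective (verticalLift J) := by
  have h := hasMFDerivAt_fiber_inclusion J
  let e := trivializationAt (E →L[ℝ] E) (fun x : M => EndFiber E x) J.1
  let L : EndFiber E J.1 ≃L[ℝ] (E →L[ℝ] E) :=
    e.continuousLinearEquivAt ℝ J.1 (FiberBundle.mem_baseSet_trivializationAt' J.1)
  have h1 : ContMDiffAt (endModel E) 𝓘(ℝ, E →L[ℝ] E) ∞ (fun p : EndBundle E M => (e p).2) J :=
    (contMDiffAt_totalSpace.1 (contMDiffAt_id (x := J))).2
  have h2 := HasMFDerivAt.comp (f := fun A : E →L[ℝ] E => (⟨J.1, A⟩ : EndBundle E M)) _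
    (h1.mdifferentiableAt (by simp)).hasMFDerivAt h
  have h3 : HasMFDerivAt 𝓘(ℝ, E →L[ℝ] E) 𝓘(ℝ, E →L[ℝ] E)
      (fun A : E →L[ℝ] E => (L : EndFiber E J.1 →L[ℝ] E →L[ℝ] E) A) J.2
      (L : EndFiber E J.1 →L[ℝ] E →L[ℝ] E) :=
    (ContinuousLinearMap.hasFDerivAt (𝕜 := ℝ) (E := E →L[ℝ] E) (F := E →L[ℝ] E)
      (L : EndFiber E J.1 →L[ℝ] E →L[ℝ] E)).hasMFDerivAt
  have h4 := hasMFDerivAt_unique h2 h3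
  have key : ∀ A : EndFiber E J.1,
      mfderiv (endModel E) 𝓘(ℝ, E →L[ℝ] E) (fun p : EndBundle E M => (e p).2) J
        (verticalLift J A) = L A :=
    fun A => congrArg (fun f => f A) h4
  intro A B hAB
  apply L.injective
  rw [← key A, ← key B, hAB]

/-- The derivative at `J` of the bundle projection `End(TM) → M`. -/
def projDeriv (J : EndBundle E M) :
    TangentSpace (endModel E) J →L[ℝ] TangentSpace 𝓘(ℝ, E) J.1 :=
  mfderiv (endModel E) 𝓘(ℝ, E) (TotalSpace.proj : EndBundle E M → M) J

theorem hasMFDerivAt_proj (J : EndBundle E M) :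
    HasMFDerivAt (endModel E) 𝓘(ℝ, E) (TotalSpace.proj : EndBundle E M → M) J (projDeriv J) :=
  (((contMDiff_proj (n := ∞) (fun x : M => EndFiber E x)).mdifferentiable (by simp)) J).hasMFDerivAt
    (I := endModel E) (I' := 𝓘(ℝ, E))

theorem projDeriv_verticalLift (J : EndBundle E M) (A : EndFiber E J.1) :
    projDeriv J (verticalLift J A) = 0 := by
  have h2 := HasMFDerivAt.comp (f := fun A : E →L[ℝ] E => (⟨J.1, A⟩ : EndBundle E M)) _
    (hasMFDerivAt_proj J) (hasMFDerivAt_fiber_inclusion J)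
  have h3 := hasMFDerivAt_const (I := 𝓘(ℝ, E →L[ℝ] E)) (I' := 𝓘(ℝ, E)) J.1
    (show E →L[ℝ] E from J.2)
  exact congrArg (fun f => f A) (hasMFDerivAt_unique h2 h3)

theorem projDeriv_sectionThroughDeriv (J : EndBundle E M) (X : TangentSpace 𝓘(ℝ, E) J.1) :
    projDeriv J (sectionThroughDeriv J X) = X := by
  have h := (sectionThrough_mdifferentiableAt J).hasMFDerivAt
  have h1 := hasMFDerivAt_proj J
  rw [← sectionThrough_self J] at h1
  have h2 := HasMFDerivAt.comp (f := (fun y => (⟨y, sectionThrough J y⟩ : EndBundle E M)))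
    J.1 h1 h
  have h3 := hasMFDerivAt_id (I := 𝓘(ℝ, E)) J.1
  have h5 : projDeriv ⟨J.1, sectionThrough J J.1⟩ (mfderiv 𝓘(ℝ, E) (endModel E)
      (fun y : M => (⟨y, sectionThrough J y⟩ : EndBundle E M)) J.1 X) = X :=
    congrArg (fun f => f X) (hasMFDerivAt_unique h2 h3)
  rw [sectionThrough_self] at h5
  exact h5

variable [FiniteDimensional ℝ E]

/-- The connection induced by `D` on `End(TM)`: for a section `s` of `End(TM)` that is
differentiable at `x`, the covariant derivative `∇_X s` is the endomorphism
`Y ↦ ∇_X (s Y) - s (∇_X Y)` of the tangent space at `x`. -/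
def endDeriv (D : LinearConnection E M) (s : Π x : M, EndFiber E x) (x : M)
    (hs : MDifferentiableAt 𝓘(ℝ, E) (endModel E) (fun y => (⟨y, s y⟩ : EndBundle E M)) x) :
    TangentSpace 𝓘(ℝ, E) x →ₗ[ℝ] EndFiber E x where
  toFun X := TensorialAt.mkHom _ x (endDeriv_tensorial D s x hs X)
  map_add' X X' := by
    ext Y
    simp [TensorialAt.mkHom_apply_eq_extend]
    abel
  map_smul' c X := by
    ext Y
    simp [TensorialAt.mkHom_apply_eq_extend, smul_sub]

/-- The horizontal lift at `J` for the connection `D`: the lift of `X` is `ds(X)` minus the vertical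
vector `∇_X s`, where `s` is a section of `End(TM)` through `J` (the result does not depend on `s`).
In particular it is `ds(X)` if `∇_X s = 0`. -/
def horizontalLift (D : LinearConnection E M) (J : EndBundle E M) :
    TangentSpace 𝓘(ℝ, E) J.1 →ₗ[ℝ] TangentSpace (endModel E) J :=
  (sectionThroughDeriv J).toLinearMap - (verticalLift J).toLinearMap ∘ₗ
    endDeriv D (sectionThrough J) J.1 (sectionThrough_mdifferentiableAt J)

theorem projDeriv_horizontalLift (D : LinearConnection E M) (J : EndBundle E M)
    (X : TangentSpace 𝓘(ℝ, E) J.1) : projDeriv J (horizontalLift D J X) = X := by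
  have h : horizontalLift D J X = sectionThroughDeriv J X - verticalLift J
      (endDeriv D (sectionThrough J) J.1 (sectionThrough_mdifferentiableAt J) X) := rfl
  rw [h, ContinuousLinearMap.map_sub, projDeriv_sectionThroughDeriv, projDeriv_verticalLift,
    sub_zero]

theorem splitting_injective (D : LinearConnection E M) (J : EndBundle E M) :
    Function.Injective ((horizontalLift D J).coprod (verticalLift J).toLinearMap) := by
  rw [← LinearMap.ker_eq_bot, LinearMap.ker_eq_bot']
  rintro ⟨X, A⟩ h
  have h' : horizontalLift D J X + verticalLift J A = 0 := h
  have hX : X = 0 := by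
    have h1 := congrArg (projDeriv J) h'
    rwa [ContinuousLinearMap.map_add, projDeriv_horizontalLift, projDeriv_verticalLift, add_zero,
      ContinuousLinearMap.map_zero] at h1
  subst hX
  rw [LinearMap.map_zero, zero_add] at h'
  rw [verticalLift_injective J (h'.trans (ContinuousLinearMap.map_zero _).symm)]
  rfl

/-- The splitting of the tangent space of `End(TM)` at `J` into horizontal and vertical vectors
for the connection `D`: it sends `(X, A)` to the sum of the horizontal lift of `X` and the vertical
vector `A`. -/
def splitting (D : LinearConnection E M) (J : EndBundle E M) :
    (TangentSpace 𝓘(ℝ, E) J.1 × EndFiber E J.1) ≃ₗ[ℝ] TangentSpace (endModel E) J :=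
  haveI : FiniteDimensional ℝ (TangentSpace 𝓘(ℝ, E) J.1 × EndFiber E J.1) :=
    inferInstanceAs (FiniteDimensional ℝ (E × (E →L[ℝ] E)))
  haveI : FiniteDimensional ℝ (TangentSpace (endModel E) J) :=
    inferInstanceAs (FiniteDimensional ℝ (E × (E →L[ℝ] E)))
  LinearEquiv.ofInjectiveOfFinrankEq
    ((horizontalLift D J).coprod (verticalLift J).toLinearMap) (splitting_injective D J) rfl

theorem splitting_apply (D : LinearConnection E M) (J : EndBundle E M)
    (X : TangentSpace 𝓘(ℝ, E) J.1) (A : EndFiber E J.1) :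
    splitting D J (X, A) = horizontalLift D J X + verticalLift J A := rfl

/-- The endomorphism `A ↦ J A` of the space of endomorphisms of a tangent space. -/
def leftComp {x : M} (J : EndFiber E x) : EndFiber E x →ₗ[ℝ] EndFiber E x where
  toFun A := J ∘L A
  map_add' A B := by ext; simp
  map_smul' c A := by ext; simp

/-- The natural almost complex structure associated to the linear connection `D`, at the point `J`:
on horizontal vectors it is the horizontal lift of `J`, on vertical vectors it is `A ↦ J A`.
The natural almost complex structure of `I(TM)` at a complex structure `J` is the restriction of
this operator to the tangent space of `I(TM)` at `J`, whose vertical vectors are the endomorphisms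
`A` with `A J + J A = 0`. -/
def naturalComplexStructure (D : LinearConnection E M) (J : EndBundle E M) :
    TangentSpace (endModel E) J →ₗ[ℝ] TangentSpace (endModel E) J :=
  (splitting D J).toLinearMap ∘ₗ
    (LinearMap.prodMap (J.2.toLinearMap) (leftComp J.2)) ∘ₗ (splitting D J).symm.toLinearMap

theorem naturalComplexStructure_apply (D : LinearConnection E M) (J : EndBundle E M)
    (X : TangentSpace 𝓘(ℝ, E) J.1) (A : EndFiber E J.1) :
    naturalComplexStructure D J (horizontalLift D J X + verticalLift J A) =
      horizontalLift D J (J.2 X) + verticalLift J (J.2 ∘L A) := by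
  rw [← splitting_apply, ← splitting_apply]
  change splitting D J (LinearMap.prodMap (J.2.toLinearMap) (leftComp J.2)
    ((splitting D J).symm (splitting D J (X, A)))) = _
  rw [LinearEquiv.symm_apply_apply]
  rfl

/-! ### Riemannian connections -/

/-- `D` is the Riemannian (Levi-Civita) connection of the metric `g`: it has no torsion and is
compatible with `g`. -/
def IsLeviCivita (g : RiemMetric E M) (D : LinearConnection E M) : Prop :=
  D.torsion = 0 ∧
    letI : RiemannianBundle (fun x : M => TangentSpace 𝓘(ℝ, E) x) := ⟨g.toRiemannianMetric⟩
    CovariantDerivative.IsMetricCompatible (F := E) (V := fun x : M => TangentSpace 𝓘(ℝ, E) x) D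

end ConformalTwistor

end

open ConformalTwistor

noncomputable section

set_option maxSynthPendingDepth 3

namespace ConformalTwistor

/-! ### Linear algebra on the model space -/

section LinearAlgebra

variable {E : Type*} [NormedAddCommGroup E] [NormedSpace ℝ E]

/-! In a chart of $M$ the bundle $\mathrm{End}(TM)$ becomes $E \times \mathrm{End}(E)$, and the
natural structure of a connection with Christoffel symbol $\Gamma$ becomes `modelJ`: $(u,b) \mapsto
(au,\; a(b+[\Gamma_u,a]) - [\Gamma_{au},a])$ at a point with second component $a$
(`trN_naturalComplexStructure`). Two connections therefore give the same structure at $a$ exactly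
when $A = \Gamma' - \Gamma$ satisfies $[A_{au},a] = a[A_u,a]$ for all $u$. For the Levi-Civita
connections of $g$ and $e^{2\varphi}g$ the Koszul argument gives $A_u v = \theta(u)v + \theta(v)u -
g(u,v)\theta^\sharp$ with $\theta = d\varphi$, and the identity follows when $a^2=-1$ and $a$ is
$g$-isometric (`modelJ_eq_of_conformal`). The equality holds on the whole tangent space of
$\mathrm{End}(TM)$ at such a point.

For the submanifold, fix one metric $g$ of the class; conformal factors do not affect the isometry
condition. A local frame in which $g$ is constant, obtained from an operator square root
(`exists_frame`), reduces the fibres of $H(TM)$ to a fixed one. There a Cayley transform based at a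
point $a_0$ maps the isometric complex structures near $a_0$ into the vector space of skew
endomorphisms anticommuting with $a_0$ (`exists_flattening`).

The tangent space of $H(TM)$ consists of the vectors whose vertical part for the Levi-Civita
connection is skew and anticommutes with $a$ (`mem_tangentSubspace_iff`). One inclusion
differentiates the defining equations along a curve; the other pulls straight lines back through the
flattening. Left multiplication by $a$ preserves this condition, so the natural structure restricts
to $H(TM)$. Smoothness comes from the Koszul formula for the symbol, and the existence of a
Levi-Civita connection (`isLeviCivita_leviCivita`) both produces $j$ and makes it unique. -/

/-- The set of endomorphisms that are skew for the bilinear form `β`. -/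
def skewEnd (β : E →L[ℝ] E →L[ℝ] ℝ) : Submodule ℝ (E →L[ℝ] E) where
  carrier := {b | ∀ v w, β (b v) w + β v (b w) = 0}
  add_mem' {b c} hb hc v w := by
    have h1 := hb v w
    have h2 := hc v w
    simp only [add_apply, map_add]
    linear_combination h1 + h2
  zero_mem' v w := by simp
  smul_mem' r b hb v w := by
    have h1 := hb v w
    simp only [smul_apply, map_smul, smul_eq_mul]
    linear_combination r * h1

theorem mem_skewEnd {β : E →L[ℝ] E →L[ℝ] ℝ} {b : E →L[ℝ] E} :
    b ∈ skewEnd β ↔ ∀ v w, β (b v) w + β v (b w) = 0 := Iff.rfl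

/-- The set of endomorphisms that anticommute with `a`. -/
def anticommEnd (a : E →L[ℝ] E) : Submodule ℝ (E →L[ℝ] E) where
  carrier := {b | b * a + a * b = 0}
  add_mem' {b c} hb hc := by
    simp only [Set.mem_ofPred_eq] at *
    rw [add_mul, mul_add, add_add_add_comm, hb, hc, add_zero]
  zero_mem' := by simp
  smul_mem' r b hb := by
    simp only [Set.mem_ofPred_eq] at *
    rw [smul_mul_assoc, mul_smul_comm, ← smul_add, hb, smul_zero]

theorem mem_anticommEnd {a b : E →L[ℝ] E} : b ∈ anticommEnd a ↔ b * a + a * b = 0 := Iff.rfl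

/-- `a` is a complex structure that is isometric for `β`. -/
def IsIsometricComplex (β : E →L[ℝ] E →L[ℝ] ℝ) (a : E →L[ℝ] E) : Prop :=
  a * a = -1 ∧ ∀ v w, β (a v) (a w) = β v w

/-- Put $aw$ for $w$ in the isometry condition and use $a^2 = -1$. -/
theorem IsIsometricComplex.mem_skewEnd {β : E →L[ℝ] E →L[ℝ] ℝ} {a : E →L[ℝ] E}
    (h : IsIsometricComplex β a) : a ∈ skewEnd β := by
  intro v w
  have h1 := h.2 v (a w)
  have h2 : a (a w) = -w := congrArg (fun f => f w) h.1
  rw [h2, map_neg] at h1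
  linear_combination -h1

/-- The vertical component, for the connection with Christoffel symbol `Γ`, of a tangent vector
`(u, b)` to `E × End E` at a point with second component `a`. -/
def vertPart (Γ : E →L[ℝ] E →L[ℝ] E) (a : E →L[ℝ] E) :
    E × (E →L[ℝ] E) →ₗ[ℝ] (E →L[ℝ] E) where
  toFun w := w.2 + (Γ w.1 * a - a * Γ w.1)
  map_add' w w' := by simp only [Prod.fst_add, Prod.snd_add, map_add, add_mul, mul_add]; abel
  map_smul' r w := by
    simp [smul_sub]

theorem vertPart_apply (Γ : E →L[ℝ] E →L[ℝ] E) (a : E →L[ℝ] E) (u : E) (b : E →L[ℝ] E) :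
    vertPart Γ a (u, b) = b + (Γ u * a - a * Γ u) := rfl

/-- The almost complex structure associated to the connection with Christoffel symbol `Γ`, on the
tangent space to `E × End E` at a point with second component `a`. -/
def modelJ (Γ : E →L[ℝ] E →L[ℝ] E) (a : E →L[ℝ] E) :
    E × (E →L[ℝ] E) →ₗ[ℝ] E × (E →L[ℝ] E) where
  toFun w := (a w.1, a * vertPart Γ a w - (Γ (a w.1) * a - a * Γ (a w.1)))
  map_add' w w' := by
    ext1
    · simp
    · simp only [Prod.fst_add, map_add, add_mul, mul_add, Prod.snd_add]; abel
  map_smul' r w := by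
    ext1
    · simp
    · simp [smul_sub]

theorem modelJ_fst (Γ : E →L[ℝ] E →L[ℝ] E) (a : E →L[ℝ] E) (w : E × (E →L[ℝ] E)) :
    (modelJ Γ a w).1 = a w.1 := rfl

theorem modelJ_snd (Γ : E →L[ℝ] E →L[ℝ] E) (a : E →L[ℝ] E) (w : E × (E →L[ℝ] E)) :
    (modelJ Γ a w).2 = a * vertPart Γ a w - (Γ (a w.1) * a - a * Γ (a w.1)) := rfl

theorem vertPart_modelJ (Γ : E →L[ℝ] E →L[ℝ] E) (a : E →L[ℝ] E) (w : E × (E →L[ℝ] E)) :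
    vertPart Γ a (modelJ Γ a w) = a * vertPart Γ a w := by
  change (modelJ Γ a w).2 + (Γ (modelJ Γ a w).1 * a - a * Γ (modelJ Γ a w).1) = _
  rw [modelJ_snd, modelJ_fst, sub_add_cancel]

/-- The pair (first component, vertical part) is the horizontal-vertical splitting in coordinates.
In it `modelJ` is just multiplication by $a$ on both factors, so identities are best checked there.
-/
theorem ext_vertPart {Γ : E →L[ℝ] E →L[ℝ] E} {a : E →L[ℝ] E} {w w' : E × (E →L[ℝ] E)}
    (h1 : w.1 = w'.1) (h2 : vertPart Γ a w = vertPart Γ a w') : w = w' := by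
  ext1
  · exact h1
  · change w.2 + (Γ w.1 * a - a * Γ w.1) = w'.2 + (Γ w'.1 * a - a * Γ w'.1) at h2
    rw [h1] at h2
    exact add_right_cancel h2

/-- The tangent vectors to the space of isometric complex structures, in coordinates. -/
def modelTangent (β : E →L[ℝ] E →L[ℝ] ℝ) (Γ : E →L[ℝ] E →L[ℝ] E) (a : E →L[ℝ] E) :
    Submodule ℝ (E × (E →L[ℝ] E)) :=
  (anticommEnd a ⊓ skewEnd β).comap (vertPart Γ a)

theorem mem_modelTangent {β : E →L[ℝ] E →L[ℝ] ℝ} {Γ : E →L[ℝ] E →L[ℝ] E} {a : E →L[ℝ] E}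
    {w : E × (E →L[ℝ] E)} :
    w ∈ modelTangent β Γ a ↔ vertPart Γ a w ∈ anticommEnd a ∧ vertPart Γ a w ∈ skewEnd β :=
  Iff.rfl

theorem mul_mem_anticommEnd {a b : E →L[ℝ] E} (hb : b ∈ anticommEnd a) :
    a * b ∈ anticommEnd a := by
  rw [mem_anticommEnd] at *
  rw [mul_assoc, ← mul_add, hb, mul_zero]

/-- With $*$ the $\beta$-adjoint, $(ab)^* = b^*a^* = ba = -ab$. -/
theorem mul_mem_skewEnd {β : E →L[ℝ] E →L[ℝ] ℝ} {a b : E →L[ℝ] E} (ha : a ∈ skewEnd β)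
    (hb : b ∈ skewEnd β) (hab : b ∈ anticommEnd a) : a * b ∈ skewEnd β := by
  intro v w
  have h1 := ha (b v) w
  have h2 := hb v (a w)
  have h3 : b (a w) + a (b w) = 0 := congrArg (fun f => f w) hab
  have h4 : a (b w) = -b (a w) := by rw [← add_eq_zero_iff_eq_neg, add_comm]; exact h3
  change β (a (b v)) w + β v (a (b w)) = 0
  rw [h4, map_neg]
  linear_combination h1 - h2

theorem modelJ_mem_modelTangent {β : E →L[ℝ] E →L[ℝ] ℝ} {Γ : E →L[ℝ] E →L[ℝ] E}
    {a : E →L[ℝ] E} (ha : IsIsometricComplex β a) {w : E × (E →L[ℝ] E)}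
    (hw : w ∈ modelTangent β Γ a) : modelJ Γ a w ∈ modelTangent β Γ a := by
  rw [mem_modelTangent, vertPart_modelJ]
  exact ⟨mul_mem_anticommEnd hw.1, mul_mem_skewEnd ha.mem_skewEnd hw.2 hw.1⟩

/-- Commutators $[c,a]$ are the infinitesimal conjugations of $a$, hence tangent to the set
$a^2=-1$; for skew $c$ they also preserve the isometry condition, which is the next lemma. -/
theorem commutator_mem_anticommEnd {a : E →L[ℝ] E} (ha : a * a = -1) (c : E →L[ℝ] E) :
    c * a - a * c ∈ anticommEnd a := by
  rw [mem_anticommEnd, sub_mul, mul_sub, mul_assoc, ← mul_assoc a a, ha]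
  noncomm_ring

theorem commutator_mem_skewEnd {β : E →L[ℝ] E →L[ℝ] ℝ} {a c : E →L[ℝ] E} (ha : a ∈ skewEnd β)
    (hc : c ∈ skewEnd β) : c * a - a * c ∈ skewEnd β := by
  intro v w
  have h1 := ha (c v) w
  have h2 := hc v (a w)
  have h3 := ha v (c w)
  have h4 := hc (a v) w
  change β (c (a v) - a (c v)) w + β v (c (a w) - a (c w)) = 0
  simp only [map_sub, sub_apply]
  linear_combination h4 + h2 - h1 - h3

theorem end_mul_apply (a b : E →L[ℝ] E) (v : E) : (a * b) v = a (b v) := rfl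

/-- The natural almost complex structure does not change at an isometric complex structure when the
metric changes conformally. -/
theorem modelJ_eq_of_conformal {β : E →L[ℝ] E →L[ℝ] ℝ} (hβ : ∀ v w, β v w = β w v)
    (hnd : ∀ v, (∀ w, β v w = 0) → v = 0) {Γ Γ' : E →L[ℝ] E →L[ℝ] E}
    (hΓ : ∀ u v, Γ u v = Γ v u) (hΓ' : ∀ u v, Γ' u v = Γ' v u) (θ : E →L[ℝ] ℝ)
    (h : ∀ u v w, β ((Γ' u - Γ u) v) w + β v ((Γ' u - Γ u) w) = 2 * θ u * β v w)
    {a : E →L[ℝ] E} (ha : IsIsometricComplex β a) : modelJ Γ a = modelJ Γ' a := by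
  obtain ⟨A, hA⟩ : ∃ A : E → E →L[ℝ] E, ∀ u, A u = Γ' u - Γ u := ⟨_, fun _ => rfl⟩
  simp only [← hA] at h
  have hsym : ∀ u v, A u v = A v u := fun u v => by
    rw [hA, hA, sub_apply, sub_apply, hΓ, hΓ']
  -- Koszul's trick: since $A$ is symmetric, the combination of `h` over $(u,v,w)$, $(v,u,w)$ and
  -- minus $(w,u,v)$ isolates $A_uv$.
  have ksz : ∀ u v w, β (A u v) w = θ u * β v w + θ v * β u w - θ w * β u v := by
    intro u v w
    have h1 := h u v w
    have h2 := h v u w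
    have h3 := h w u v
    rw [hsym v u] at h2
    rw [hsym w u, hsym w v, hβ u (A v w)] at h3
    rw [hβ v] at h1
    rw [hβ u (A v w)] at h2
    linear_combination (h1 + h2 - h3) / 2
  have haa : ∀ x, a (a x) = -x := fun x => congrArg (fun f => f x) ha.1
  have hs : ∀ v w, β (a v) w = -β v (a w) := fun v w => by
    have := ha.mem_skewEnd v w
    linear_combination this
  -- This is $[A_{au},a] = a[A_u,a]$, the vanishing of the difference of the two structures. Moving
  -- every $a$ across $\beta$ with `hs` and inserting `ksz` leaves a scalar identity.
  have key : ∀ u y, A (a u) (a y) - a (A (a u) y) - (a (A u (a y)) - a (a (A u y))) = 0 := by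
    intro u y
    apply hnd
    intro w
    simp only [map_sub, sub_apply, hs, ksz, haa, map_neg, neg_apply]
    ring
  refine LinearMap.ext fun ⟨u, b⟩ => ?_
  ext1
  · rfl
  · rw [modelJ_snd, modelJ_snd, vertPart_apply, vertPart_apply]
    ext y
    have := key u y
    simp only [hA, sub_apply, add_apply, end_mul_apply, map_sub, map_add] at this ⊢
    rw [← sub_eq_zero, ← this]
    abel

end LinearAlgebra

/-! ### Metrics and their Christoffel symbols on the model space -/

section Metric

variable {E : Type*} [NormedAddCommGroup E] [NormedSpace ℝ E]

/-- `β` is symmetric and positive definite. -/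
structure IsMetricForm (β : E →L[ℝ] E →L[ℝ] ℝ) : Prop where
  symm : ∀ v w, β v w = β w v
  pos : ∀ v, v ≠ 0 → 0 < β v v

theorem IsMetricForm.eq_zero {β : E →L[ℝ] E →L[ℝ] ℝ} (hβ : IsMetricForm β) (v : E)
    (h : ∀ w, β v w = 0) : v = 0 := by
  by_contra hv
  exact (hβ.pos v hv).ne' (h v)

theorem IsMetricForm.ext {β : E →L[ℝ] E →L[ℝ] ℝ} (hβ : IsMetricForm β) {v v' : E}
    (h : ∀ w, β v w = β v' w) : v = v' := by
  rw [← sub_eq_zero]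
  refine hβ.eq_zero _ fun w => ?_
  rw [map_sub, sub_apply, h, sub_self]

variable [FiniteDimensional ℝ E]

theorem IsMetricForm.isInvertible {β : E →L[ℝ] E →L[ℝ] ℝ} (hβ : IsMetricForm β) :
    β.IsInvertible := by
  have hinj : Function.Injective (β : E →ₗ[ℝ] (E →L[ℝ] ℝ)) := fun v v' h => hβ.ext fun w =>
    congrArg (fun f : E →L[ℝ] ℝ => f w) h
  have hrank : Module.finrank ℝ E = Module.finrank ℝ (E →L[ℝ] ℝ) := by
    rw [← LinearEquiv.finrank_eq (LinearMap.toContinuousLinearMap (𝕜 := ℝ) (E := E) (F' := ℝ))]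
    exact (Subspace.dual_finrank_eq (K := ℝ) (V := E)).symm
  exact ⟨(LinearEquiv.ofInjectiveOfFinrankEq _ hinj hrank).toContinuousLinearEquiv, rfl⟩

/-- The Christoffel symbol, given by the Koszul formula, of a metric on a vector space with value
`β` and derivative `β'` at a point. -/
def christoffel (β : E →L[ℝ] E →L[ℝ] ℝ) (β' : E →L[ℝ] E →L[ℝ] E →L[ℝ] ℝ) : E →L[ℝ] E →L[ℝ] E :=
  (LinearMap.mk₂ ℝ (fun u v => β.inverse ((1 / 2 : ℝ) • (β' u v + β' v u - (β'.flip u).flip v)))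
    (fun u u' v => by rw [← map_add]; congr 1; ext; simp; ring)
    (fun c u v => by rw [← map_smul]; congr 1; ext; simp; ring)
    (fun u v v' => by rw [← map_add]; congr 1; ext; simp; ring)
    (fun c u v => by rw [← map_smul]; congr 1; ext; simp; ring)).toContinuousBilinearMap

theorem christoffel_apply (β : E →L[ℝ] E →L[ℝ] ℝ) (β' : E →L[ℝ] E →L[ℝ] E →L[ℝ] ℝ) (u v : E) :
    christoffel β β' u v =
      β.inverse ((1 / 2 : ℝ) • (β' u v + β' v u - (β'.flip u).flip v)) := rfl

variable {β : E →L[ℝ] E →L[ℝ] ℝ} {β' : E →L[ℝ] E →L[ℝ] E →L[ℝ] ℝ}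

theorem IsMetricForm.christoffel_inner (hβ : IsMetricForm β) (u v w : E) :
    β (christoffel β β' u v) w = (β' u v w + β' v u w - β' w u v) / 2 := by
  rw [christoffel_apply, hβ.isInvertible.self_apply_inverse]
  simp
  ring

theorem IsMetricForm.christoffel_symm (hβ : IsMetricForm β) (hs : ∀ u v w, β' u v w = β' u w v)
    (u v : E) : christoffel β β' u v = christoffel β β' v u := by
  apply hβ.ext
  intro w
  rw [hβ.christoffel_inner, hβ.christoffel_inner, hs w u v]
  ring

theorem IsMetricForm.christoffel_metric (hβ : IsMetricForm β) (hs : ∀ u v w, β' u v w = β' u w v)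
    (u v w : E) :
    β' u v w = β (christoffel β β' u v) w + β v (christoffel β β' u w) := by
  rw [hβ.symm v, hβ.christoffel_inner, hβ.christoffel_inner, hs v u w, hs w u v, hs u w v]
  ring

/-- Uniqueness of the Levi-Civita connection: the metric equations for the three permutations,
combined with the symmetry of $\Gamma$, leave only $2\beta(\Gamma_uv,w)$. -/
theorem IsMetricForm.eq_christoffel (hβ : IsMetricForm β) {Γ : E →L[ℝ] E →L[ℝ] E}
    (hΓ : ∀ u v, Γ u v = Γ v u) (h : ∀ u v w, β' u v w = β (Γ u v) w + β v (Γ u w)) :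
    Γ = christoffel β β' := by
  ext u v
  apply hβ.ext
  intro w
  rw [hβ.christoffel_inner, h u v w, h v u w, h w u v, hΓ w u, hΓ w v, hΓ v u, hβ.symm u (Γ v w),
    hβ.symm v (Γ u w)]
  ring

/-- The Christoffel symbol of a smooth metric is smooth. -/
theorem contDiffOn_christoffel {U : Set E} (hU : IsOpen U) {β : E → E →L[ℝ] E →L[ℝ] ℝ}
    (hβ : ∀ y ∈ U, IsMetricForm (β y)) (hs : ContDiffOn ℝ ∞ β U) :
    ContDiffOn ℝ ∞ (fun y => christoffel (β y) (fderiv ℝ β y)) U := by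
  -- Inverting $\beta$ is the only nonlinear ingredient of the Koszul formula; inversion is smooth
  -- at invertible maps.
  have hinv : ContDiffOn ℝ ∞ (fun y => (β y).inverse) U := fun y hy =>
    ((hβ y hy).isInvertible.contDiffAt_map_inverse).comp_contDiffWithinAt y (hs y hy)
  have hd : ContDiffOn ℝ ∞ (fderiv ℝ β) U := hs.fderiv_of_isOpen hU (by simp)
  rw [contDiffOn_clm_apply]
  intro u
  rw [contDiffOn_clm_apply]
  intro v
  simp only [christoffel_apply]
  refine hinv.clm_apply ?_
  rw [contDiffOn_clm_apply]
  intro w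
  have h1 : ∀ a b c : E, ContDiffOn ℝ ∞ (fun y => fderiv ℝ β y a b c) U := fun a b c =>
    ((hd.clm_apply contDiffOn_const).clm_apply contDiffOn_const).clm_apply contDiffOn_const
  exact contDiffOn_const.mul (((h1 u v w).add (h1 v u w)).sub (h1 w u v))

/-- The map `X ↦ X * X` has a smooth local inverse at `1`. -/
theorem exists_localInverse_sq :
    ∃ (e : OpenPartialHomeomorph (E →L[ℝ] E) (E →L[ℝ] E)),
      (∀ X, e X = X * X) ∧ (1 : E →L[ℝ] E) ∈ e.source ∧ ContDiffAt ℝ ω e.symm 1 := by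
  have : CompleteSpace E := FiniteDimensional.complete ℝ E
  let f : (E →L[ℝ] E) → (E →L[ℝ] E) := fun X => X * X
  have hf : ContDiffAt ℝ ω f 1 := contDiffAt_id.mul contDiffAt_id
  let f' : (E →L[ℝ] E) ≃L[ℝ] (E →L[ℝ] E) :=
    ContinuousLinearEquiv.smulLeft (Units.mk0 (2 : ℝ) two_ne_zero)
  have hf' : HasFDerivAt f (f' : (E →L[ℝ] E) →L[ℝ] (E →L[ℝ] E)) 1 := by
    refine ((hasFDerivAt_id (𝕜 := ℝ) (1 : E →L[ℝ] E)).mul' (hasFDerivAt_id _)).congr_fderiv ?_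
    ext1 X
    change (1 : E →L[ℝ] E) * X + X * 1 = (2 : ℝ) • X
    rw [one_mul, mul_one, two_smul]
  have h0 : (ω : WithTop ℕ∞) ≠ 0 := by simp
  refine ⟨hf.toOpenPartialHomeomorph f hf' h0, fun _ => rfl,
    hf.mem_toOpenPartialHomeomorph_source hf' h0, ?_⟩
  have := hf.to_localInverse hf' h0
  rwa [show f 1 = 1 from mul_one 1] at this

open Filter Topology in
/-- A smooth metric on an open subset of a vector space admits, near any point, a smooth frame
that is the identity at the point and in which the metric is constant. -/
theorem exists_frame {U : Set E} (hU : IsOpen U) {β : E → E →L[ℝ] E →L[ℝ] ℝ}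
    (hβ : ∀ y ∈ U, IsMetricForm (β y)) (hs : ContDiffOn ℝ ∞ β U) {y₀ : E} (hy₀ : y₀ ∈ U) :
    ∃ (V : Set E) (P Q : E → E →L[ℝ] E), IsOpen V ∧ y₀ ∈ V ∧ V ⊆ U ∧
      ContDiffOn ℝ ∞ P V ∧ ContDiffOn ℝ ∞ Q V ∧ P y₀ = 1 ∧
      ∀ y ∈ V, P y * Q y = 1 ∧ Q y * P y = 1 ∧ ∀ v w, β y (P y v) (P y w) = β y₀ v w := by
  have : CompleteSpace E := FiniteDimensional.complete ℝ E
  obtain ⟨e, he, he1, hes⟩ := exists_localInverse_sq (E := E)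
  have hβ₀ := hβ y₀ hy₀
  have hi := hβ₀.isInvertible
  -- the operator representing `β y`
  let G : E → E →L[ℝ] E := fun y => (β y₀).inverse ∘L β y
  have hG : ∀ y v w, β y₀ (G y v) w = β y v w := fun y v w => by
    change β y₀ ((β y₀).inverse (β y v)) w = _
    rw [hi.self_apply_inverse]
  have hG1 : G y₀ = 1 := hi.inverse_comp_self
  -- the adjoint for `β y₀`
  let T : (E →L[ℝ] E) → (E →L[ℝ] E) := fun X =>
    (β y₀).inverse ∘L ((ContinuousLinearMap.compL ℝ E E ℝ).flip X ∘L β y₀)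
  have hT : ∀ X v w, β y₀ (T X v) w = β y₀ v (X w) := fun X v w => by
    change β y₀ ((β y₀).inverse ((ContinuousLinearMap.compL ℝ E E ℝ).flip X (β y₀ v))) w = _
    rw [hi.self_apply_inverse]
    rfl
  have hTc : Continuous T := by fun_prop
  have hTmul : ∀ X, T (X * X) = T X * T X := fun X => by
    ext v
    apply hβ₀.ext
    intro w
    rw [hT, end_mul_apply, end_mul_apply, hT, hT]
  have hT1 : T 1 = 1 := by
    ext v
    apply hβ₀.ext
    intro w
    rw [hT]; rfl
  have he1' : e.symm 1 = 1 := by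
    have h := e.left_inv he1
    rwa [he, mul_one] at h
  have h1t : (1 : E →L[ℝ] E) ∈ e.target := by
    have h := e.map_source he1
    rwa [he, mul_one] at h
  -- $S = G^{1/2}$, the square root near $1$. The frame is $P = S^{-1}$: once $S$ is self-adjoint
  -- for $\beta_{y_0}$, $\beta_y(Pv,Pw) = \beta_{y_0}(S^2Pv,Pw) = \beta_{y_0}(v,w)$.
  let S : E → E →L[ℝ] E := fun y => e.symm (G y)
  have hS1 : S y₀ = 1 := by simp only [S, hG1, he1']
  have hGs : ContDiffOn ℝ ∞ G U := contDiffOn_const.clm_comp hs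
  have hGc : ContinuousAt G y₀ := (hGs.continuousOn).continuousAt (hU.mem_nhds hy₀)
  have hSc : ContinuousAt S y₀ := by
    refine ContinuousAt.comp (g := e.symm) ?_ hGc
    rw [hG1]
    exact hes.continuousAt
  have ev1 : ∀ᶠ y in 𝓝 y₀, ContDiffAt ℝ ∞ S y := by
    have h1 : ∀ᶠ y in 𝓝 y₀, ContDiffAt ℝ ω e.symm (G y) := by
      refine hGc.eventually ?_
      rw [hG1]
      exact hes.eventually (by simp)
    filter_upwards [h1, hU.mem_nhds hy₀] with y hy hyU
    exact (hy.of_le (by simp)).comp y (hGs.contDiffAt (hU.mem_nhds hyU))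
  have ev2 : ∀ᶠ y in 𝓝 y₀, IsUnit (S y) := by
    refine hSc.eventually (p := IsUnit) (Units.isOpen.mem_nhds ?_)
    rw [hS1]
    exact isUnit_one
  have ev3 : ∀ᶠ y in 𝓝 y₀, G y ∈ e.target := by
    refine hGc.eventually (p := fun X => X ∈ e.target) (e.open_target.mem_nhds ?_)
    rwa [hG1]
  -- Keeps the adjoint of $S$ in the region where squaring is injective, as needed for `hTS`.
  have ev4 : ∀ᶠ y in 𝓝 y₀, T (S y) ∈ e.source := by
    refine (hTc.continuousAt.comp hSc).eventually (p := fun X => X ∈ e.source)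
      (e.open_source.mem_nhds ?_)
    rw [Function.comp_apply, hS1, hT1]
    exact he1
  obtain ⟨V, hV, hVo, hyV⟩ :=
    eventually_nhds_iff.1 (ev1.and (ev2.and (ev3.and (ev4.and (hU.mem_nhds hy₀)))))
  refine ⟨V, fun y => Ring.inverse (S y), S, hVo, hyV, fun y hy => (hV y hy).2.2.2.2, ?_,
    fun y hy => (hV y hy).1.contDiffWithinAt, ?_, fun y hy => ?_⟩
  · intro y hy
    obtain ⟨s, hsu⟩ := (hV y hy).2.1
    have := contDiffAt_ringInverse ℝ (n := ∞) s
    rw [hsu] at this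
    exact (this.comp y (hV y hy).1).contDiffWithinAt
  · simp only [hS1, Ring.inverse_one]
  · obtain ⟨-, hu, ht, hTs, hyU⟩ := hV y hy
    have hPQ := Ring.inverse_mul_cancel _ hu
    have hQP := Ring.mul_inverse_cancel _ hu
    refine ⟨hPQ, hQP, fun v w => ?_⟩
    have hSS : S y * S y = G y := by rw [← he]; exact e.right_inv ht
    have hTG : T (G y) = G y := by
      ext v
      apply hβ₀.ext
      intro w
      rw [hT, hβ₀.symm, hG, hG, (hβ y hyU).symm]
    -- Both are square roots of $G$, because $G$ is self-adjoint, and both lie in the domain of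
    -- injectivity of squaring.
    have hTS : T (S y) = S y := by
      apply e.injOn hTs (e.map_target ht)
      rw [he, he, ← hTmul, hSS, hTG]
    rw [← hG, ← hSS]
    have h2 : S y (Ring.inverse (S y) v) = v := congrArg (fun f => f v) hQP
    have h3 : S y (Ring.inverse (S y) w) = w := congrArg (fun f => f w) hQP
    rw [end_mul_apply, h2, ← hTS, hT, h3]

end Metric

/-! ### Flattening the space of isometric complex structures -/

section Cayley

theorem ringInverse_eq_of_mul_eq_one {R : Type*} [Ring R] {a b : R} (h : a * b = 1)
    (h' : b * a = 1) : Ring.inverse a = b :=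
  Ring.inverse_unit ⟨a, b, h, h'⟩

variable {R : Type*} [Ring R] [Algebra ℝ R]

theorem isUnit_two_smul_inverse {x : R} (hx : IsUnit x) : IsUnit ((2 : ℝ) • Ring.inverse x) := by
  refine ⟨⟨(2 : ℝ) • Ring.inverse x, (1 / 2 : ℝ) • x, ?_, ?_⟩, rfl⟩ <;>
  simp [smul_smul, Ring.mul_inverse_cancel _ hx, Ring.inverse_mul_cancel _ hx]

theorem inverse_two_smul_inverse {x : R} (hx : IsUnit x) :
    Ring.inverse ((2 : ℝ) • Ring.inverse x) = (1 / 2 : ℝ) • x := by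
  apply ringInverse_eq_of_mul_eq_one <;>
  simp [smul_smul, Ring.mul_inverse_cancel _ hx, Ring.inverse_mul_cancel _ hx]

end Cayley

/-! ### Conjugation by frames and the Cayley transform in a single fibre. -/

section Flatten

variable {E : Type*} [NormedAddCommGroup E] [NormedSpace ℝ E]

theorem isIsometricComplex_conj {β β₀ : E →L[ℝ] E →L[ℝ] ℝ} {P Q : E →L[ℝ] E} (hPQ : P * Q = 1)
    (hQP : Q * P = 1) (h : ∀ v w, β (P v) (P w) = β₀ v w) (A : E →L[ℝ] E) :
    IsIsometricComplex β A ↔ IsIsometricComplex β₀ (Q * A * P) := by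
  have hQ : ∀ v, P (Q v) = v := fun v => congrArg (fun f => f v) hPQ
  have hP : ∀ v, Q (P v) = v := fun v => congrArg (fun f => f v) hQP
  refine and_congr ?_ ?_
  · have e : Q * A * P * (Q * A * P) = Q * (A * A) * P := by
      rw [show Q * A * P * (Q * A * P) = Q * A * (P * Q) * (A * P) by noncomm_ring, hPQ]
      noncomm_ring
    rw [e]
    constructor
    · intro h
      rw [h, mul_neg_one, neg_mul, hQP]
    · intro h
      calc A * A = (P * Q) * (A * A) * (P * Q) := by rw [hPQ, one_mul, mul_one]
        _ = P * (Q * (A * A) * P) * Q := by noncomm_ring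
        _ = -1 := by rw [h, mul_neg_one, neg_mul, hPQ]
  · constructor
    · intro h1 v w
      rw [← h, ← h]
      simp only [end_mul_apply, hQ]
      exact h1 _ _
    · intro h1 v w
      have := h1 (Q v) (Q w)
      rw [← h, ← h] at this
      simpa only [end_mul_apply, hQ] using this

/-- The Cayley transform `1 - 2 (C + 1)⁻¹`, where `C = -a₀ A`, identifies the isometric complex
structures `A` with the skew endomorphisms that anticommute with the complex structure `a₀`. -/
theorem isIsometricComplex_iff_cayley {β : E →L[ℝ] E →L[ℝ] ℝ} {a₀ : E →L[ℝ] E}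
    (ha₀ : IsIsometricComplex β a₀) {A : E →L[ℝ] E} (hu : IsUnit (-(a₀ * A) + 1)) :
    IsIsometricComplex β A ↔
      (1 - (2 : ℝ) • Ring.inverse (-(a₀ * A) + 1)) ∈ anticommEnd a₀ ⊓ skewEnd β := by
  -- $C = a_0^{-1}A$ is the position of $A$ relative to $a_0$: $A^2=-1$ becomes $Ca_0C = a_0$, and
  -- $A$ is isometric exactly when $C$ is.
  obtain ⟨C, hC⟩ : ∃ C, C = -(a₀ * A) := ⟨_, rfl⟩
  have hA : A = a₀ * C := by rw [hC, mul_neg, ← mul_assoc, ha₀.1]; simp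
  rw [← hC] at hu ⊢
  obtain ⟨u, hu'⟩ : ∃ u, u = Ring.inverse (C + 1) := ⟨_, rfl⟩
  have h1 : (C + 1) * u = 1 := by rw [hu']; exact Ring.mul_inverse_cancel _ hu
  have h2 : u * (C + 1) = 1 := by rw [hu']; exact Ring.inverse_mul_cancel _ hu
  rw [← hu', Submodule.mem_inf]
  refine and_congr ?_ ?_
  · rw [mem_anticommEnd]
    have e1 : A * A = -1 ↔ C * a₀ * C = a₀ := by
      rw [hA]
      constructor
      · intro h
        calc C * a₀ * C = -((a₀ * a₀) * (C * a₀ * C)) := by rw [ha₀.1]; simp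
          _ = -(a₀ * (a₀ * C * (a₀ * C))) := by noncomm_ring
          _ = a₀ := by rw [h]; simp
      · intro h
        calc a₀ * C * (a₀ * C) = a₀ * (C * a₀ * C) := by noncomm_ring
          _ = -1 := by rw [h, ha₀.1]
    have e2 : (1 - (2 : ℝ) • u) * a₀ + a₀ * (1 - (2 : ℝ) • u) = (2 : ℝ) • (a₀ - u * a₀ - a₀ * u) := by
      simp only [sub_mul, mul_sub, smul_mul_assoc, mul_smul_comm, one_mul, mul_one, smul_sub]
      module
    rw [e1, e2, smul_eq_zero, or_iff_right two_ne_zero]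
    -- Multiplying on both sides by the invertible $C+1$ clears the inverses $u = (C+1)^{-1}$; `e4`
    -- undoes it.
    have e3 : (C + 1) * (a₀ - u * a₀ - a₀ * u) * (C + 1) = C * a₀ * C - a₀ := by
      have : (C + 1) * (a₀ - u * a₀ - a₀ * u) * (C + 1) =
        (C + 1) * a₀ * (C + 1) - (C + 1) * u * a₀ * (C + 1) - (C + 1) * a₀ * (u * (C + 1)) := by
        noncomm_ring
      rw [this, h1, h2]
      noncomm_ring
    have e4 : u * (C * a₀ * C - a₀) * u = a₀ - u * a₀ - a₀ * u := by
      rw [← e3]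
      calc u * ((C + 1) * (a₀ - u * a₀ - a₀ * u) * (C + 1)) * u
          = (u * (C + 1)) * (a₀ - u * a₀ - a₀ * u) * ((C + 1) * u) := by noncomm_ring
        _ = _ := by rw [h1, h2, one_mul, mul_one]
    constructor
    · intro h
      rw [← e4, h, sub_self, mul_zero, zero_mul]
    · intro h
      rw [← sub_eq_zero, ← e3, h, mul_zero, zero_mul]
  · have k1 : ∀ v, C (u v) + u v = v := fun v => congrArg (fun f => f v) h1
    have k2 : ∀ v, u (C v) = v - u v := fun v => by
      have e : u (C v + v) = v := congrArg (fun f => f v) h2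
      rw [map_add] at e
      exact eq_sub_of_add_eq e
    have e1 : (∀ v w, β (A v) (A w) = β v w) ↔ ∀ v w, β (C v) (C w) = β v w := by
      rw [hA]
      simp only [end_mul_apply, ha₀.2]
    rw [e1, mem_skewEnd]
    constructor
    · intro h v w
      -- Every vector is $(C+1)v'$, and $1-2u$ sends it to $(C-1)v'$. Skewness thus reads
      -- $2\beta(Cv',Cw') = 2\beta(v',w')$.
      obtain ⟨v, rfl⟩ : ∃ v', v = C v' + v' := ⟨_, (k1 v).symm⟩
      obtain ⟨w, rfl⟩ : ∃ w', w = C w' + w' := ⟨_, (k1 w).symm⟩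
      simp only [sub_apply, smul_apply, one_apply_eq_self, k2, map_sub, map_smul, map_add,
        add_apply, smul_eq_mul]
      linear_combination 2 * h v w
    · intro h v w
      have := h (C v + v) (C w + w)
      simp only [sub_apply, smul_apply, one_apply_eq_self, k2, map_sub, map_smul, map_add,
        add_apply, smul_eq_mul] at this
      linear_combination this / 2

end Flatten

/-! ### The Cayley transform in family over an open set of the base. -/

section FlattenChart

open Filter Topology

variable {E : Type*} [NormedAddCommGroup E] [NormedSpace ℝ E] [FiniteDimensional ℝ E]

theorem contDiffOn_ringInverse {X : Type*} [NormedAddCommGroup X] [NormedSpace ℝ X] {S : Set X}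
    {f : X → E →L[ℝ] E} (hf : ContDiffOn ℝ ∞ f S) (hu : ∀ x ∈ S, IsUnit (f x)) :
    ContDiffOn ℝ ∞ (fun x => Ring.inverse (f x)) S := by
  have : CompleteSpace E := FiniteDimensional.complete ℝ E
  intro x hx
  obtain ⟨s, hs⟩ := hu x hx
  have h := contDiffAt_ringInverse ℝ (n := ∞) s
  rw [hs] at h
  exact h.comp_contDiffWithinAt x (hf x hx)

/-- The set of isometric complex structures for a field `β` of bilinear forms. -/
def isometricSet (U : Set E) (β : E → E →L[ℝ] E →L[ℝ] ℝ) : Set (E × (E →L[ℝ] E)) :=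
  {w | w.1 ∈ U ∧ IsIsometricComplex (β w.1) w.2}

/-- A local diffeomorphism of `E × End E` which maps the isometric complex structures near
`(y₀, a₀)` to a vector subspace. -/
theorem exists_flattening {U : Set E} {β : E → E →L[ℝ] E →L[ℝ] ℝ}
    {V : Set E} {P Q : E → E →L[ℝ] E} (hV : IsOpen V) {y₀ : E} (hy₀ : y₀ ∈ V) (hVU : V ⊆ U)
    (hP : ContDiffOn ℝ ∞ P V) (hQ : ContDiffOn ℝ ∞ Q V) (hP₀ : P y₀ = 1)
    (h : ∀ y ∈ V, P y * Q y = 1 ∧ Q y * P y = 1 ∧ ∀ v w, β y (P y v) (P y w) = β y₀ v w)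
    {a₀ : E →L[ℝ] E} (ha₀ : IsIsometricComplex (β y₀) a₀) :
    ∃ φ : OpenPartialHomeomorph (E × (E →L[ℝ] E)) (E × (E →L[ℝ] E)),
      (y₀, a₀) ∈ φ.source ∧ φ.source ⊆ V ×ˢ Set.univ ∧ ContDiffOn ℝ ∞ φ φ.source ∧
      ContDiffOn ℝ ∞ φ.symm φ.target ∧ φ (y₀, a₀) = (y₀, 0) ∧
      (∀ w, φ.symm w = (w.1, P w.1 * (a₀ * ((2 : ℝ) • Ring.inverse (1 - w.2) - 1)) * Q w.1)) ∧
      ∀ w ∈ φ.source, w ∈ isometricSet U β ↔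
        φ w ∈ Submodule.prod (⊤ : Submodule ℝ E) (anticommEnd a₀ ⊓ skewEnd (β y₀)) := by
  have : CompleteSpace E := FiniteDimensional.complete ℝ E
  let C : E × (E →L[ℝ] E) → E →L[ℝ] E := fun w => -(a₀ * (Q w.1 * w.2 * P w.1)) + 1
  have hP' : ContDiffOn ℝ ∞ (fun w : E × (E →L[ℝ] E) => P w.1) (V ×ˢ Set.univ) :=
    hP.comp contDiff_fst.contDiffOn fun w hw => hw.1
  have hQ' : ContDiffOn ℝ ∞ (fun w : E × (E →L[ℝ] E) => Q w.1) (V ×ˢ Set.univ) :=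
    hQ.comp contDiff_fst.contDiffOn fun w hw => hw.1
  have hC : ContDiffOn ℝ ∞ C (V ×ˢ Set.univ) :=
    ((contDiffOn_const.mul ((hQ'.mul contDiff_snd.contDiffOn).mul hP')).neg).add contDiffOn_const
  have hVo : IsOpen (V ×ˢ (Set.univ : Set (E →L[ℝ] E))) := hV.prod isOpen_univ
  let S : Set (E × (E →L[ℝ] E)) := (V ×ˢ Set.univ) ∩ C ⁻¹' {x | IsUnit x}
  let T : Set (E × (E →L[ℝ] E)) := (V ×ˢ Set.univ) ∩ (fun w => 1 - w.2) ⁻¹' {x | IsUnit x}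
  have hSo : IsOpen S := hC.continuousOn.isOpen_inter_preimage hVo Units.isOpen
  have hTo : IsOpen T :=
    hVo.inter (Units.isOpen.preimage (continuous_const.sub continuous_snd))
  have hφi : ContDiffOn ℝ ∞ (fun w => Ring.inverse (C w)) S :=
    contDiffOn_ringInverse (hC.mono Set.inter_subset_left) fun w hw => hw.2
  have hφ : ContDiffOn ℝ ∞ (fun w => (w.1, 1 - (2 : ℝ) • Ring.inverse (C w))) S :=
    contDiff_fst.contDiffOn.prodMk (contDiffOn_const.sub (hφi.const_smul 2))
  have hψi : ContDiffOn ℝ ∞ (fun w : E × (E →L[ℝ] E) => Ring.inverse (1 - w.2)) T :=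
    contDiffOn_ringInverse (contDiffOn_const.sub contDiff_snd.contDiffOn) fun w hw => hw.2
  have hψ : ContDiffOn ℝ ∞ (fun w : E × (E →L[ℝ] E) =>
      (w.1, P w.1 * (a₀ * ((2 : ℝ) • Ring.inverse (1 - w.2) - 1)) * Q w.1)) T :=
    contDiff_fst.contDiffOn.prodMk (((hP'.mono Set.inter_subset_left).mul (contDiffOn_const.mul
      ((hψi.const_smul 2).sub contDiffOn_const))).mul (hQ'.mono Set.inter_subset_left))
  -- Solving $X = 1 - 2C^{-1}$ gives $C = 2(1-X)^{-1}$, where `C` already includes the added $1$;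
  -- hence the inverse map uses $a_0(2(1-X)^{-1} - 1)$, conjugated back by the frame.
  have hCψ : ∀ w : E × (E →L[ℝ] E), w.1 ∈ V →
      C (w.1, P w.1 * (a₀ * ((2 : ℝ) • Ring.inverse (1 - w.2) - 1)) * Q w.1) =
        (2 : ℝ) • Ring.inverse (1 - w.2) := fun w hw => by
    obtain ⟨h1, h2, -⟩ := h w.1 hw
    generalize (2 : ℝ) • Ring.inverse (1 - w.2) = x
    change -(a₀ * (Q w.1 * (P w.1 * (a₀ * (x - 1)) * Q w.1) * P w.1)) + 1 = x
    calc _ = -(a₀ * ((Q w.1 * P w.1) * (a₀ * (x - 1)) * (Q w.1 * P w.1))) + 1 := by noncomm_ring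
      _ = -((a₀ * a₀) * (x - 1)) + 1 := by rw [h2, one_mul, mul_one, mul_assoc]
      _ = x := by rw [ha₀.1]; noncomm_ring
  have hQ₀ : Q y₀ = 1 := by
    have := (h y₀ hy₀).1
    rwa [hP₀, one_mul] at this
  have hC₀ : C (y₀, a₀) = (2 : ℝ) • 1 := by
    change -(a₀ * (Q y₀ * a₀ * P y₀)) + 1 = _
    rw [hP₀, hQ₀, one_mul, mul_one, ha₀.1, neg_neg, two_smul]
  have h2u : IsUnit ((2 : ℝ) • (1 : E →L[ℝ] E)) := by
    have := isUnit_two_smul_inverse (isUnit_one (M := E →L[ℝ] E))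
    rwa [Ring.inverse_one] at this
  let φ : OpenPartialHomeomorph (E × (E →L[ℝ] E)) (E × (E →L[ℝ] E)) :=
    { toFun := fun w => (w.1, 1 - (2 : ℝ) • Ring.inverse (C w))
      invFun := fun w => (w.1, P w.1 * (a₀ * ((2 : ℝ) • Ring.inverse (1 - w.2) - 1)) * Q w.1)
      source := S
      target := T
      map_source' := fun w hw => ⟨⟨hw.1.1, trivial⟩, by
        change IsUnit (1 - (1 - (2 : ℝ) • Ring.inverse (C w)))
        rw [sub_sub_cancel]
        exact isUnit_two_smul_inverse hw.2⟩
      map_target' := fun w hw => ⟨⟨hw.1.1, trivial⟩, by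
        change IsUnit (C _)
        rw [hCψ w hw.1.1]
        exact isUnit_two_smul_inverse hw.2⟩
      left_inv' := fun w hw => by
        ext1
        · rfl
        · change P w.1 * (a₀ * ((2 : ℝ) • Ring.inverse (1 - (1 - (2 : ℝ) • Ring.inverse (C w))) - 1))
            * Q w.1 = w.2
          obtain ⟨h1, h2, -⟩ := h w.1 hw.1.1
          rw [sub_sub_cancel, inverse_two_smul_inverse hw.2, smul_smul,
            show (2 : ℝ) * (1 / 2) = 1 by norm_num, one_smul]
          calc P w.1 * (a₀ * (-(a₀ * (Q w.1 * w.2 * P w.1)) + 1 - 1)) * Q w.1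
              = -(P w.1 * ((a₀ * a₀) * (Q w.1 * w.2 * P w.1)) * Q w.1) := by noncomm_ring
            _ = (P w.1 * Q w.1) * w.2 * (P w.1 * Q w.1) := by rw [ha₀.1]; noncomm_ring
            _ = w.2 := by rw [h1, one_mul, mul_one]
      right_inv' := fun w hw => by
        ext1
        · rfl
        · change 1 - (2 : ℝ) • Ring.inverse (C (w.1, _)) = w.2
          rw [hCψ w hw.1.1, inverse_two_smul_inverse hw.2, smul_smul,
            show (2 : ℝ) * (1 / 2) = 1 by norm_num, one_smul, sub_sub_cancel]
      open_source := hSo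
      open_target := hTo
      continuousOn_toFun := hφ.continuousOn
      continuousOn_invFun := hψ.continuousOn }
  refine ⟨φ, ⟨⟨hy₀, trivial⟩, ?_⟩, Set.inter_subset_left, hφ, hψ, ?_, fun _ => rfl, ?_⟩
  · change IsUnit (C (y₀, a₀))
    rw [hC₀]
    exact h2u
  · change (y₀, 1 - (2 : ℝ) • Ring.inverse (C (y₀, a₀))) = (y₀, 0)
    have e := inverse_two_smul_inverse (isUnit_one (M := E →L[ℝ] E))
    rw [Ring.inverse_one] at e
    rw [hC₀, e, smul_smul, show (2 : ℝ) * (1 / 2) = 1 by norm_num, one_smul, sub_self]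
  · intro w hw
    obtain ⟨h1, h2, h3⟩ := h w.1 hw.1.1
    have e1 : w ∈ isometricSet U β ↔ IsIsometricComplex (β w.1) w.2 :=
      and_iff_right (hVU hw.1.1)
    rw [e1, isIsometricComplex_conj h1 h2 h3, isIsometricComplex_iff_cayley ha₀ hw.2]
    exact (and_iff_right trivial).symm

end FlattenChart

/-! ### Velocities of curves of isometric complex structures. -/

section Velocity

open Filter Topology

variable {E : Type*} [NormedAddCommGroup E] [NormedSpace ℝ E]

/-- Differentiate $a^2=-1$ and $\beta(av,z)+\beta(v,az)=0$ along the curve. The derivative of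
$\beta$ enters the second equation through $\Gamma$ by metric compatibility, which turns $b$ into
its vertical part $b+[\Gamma_u,a]$. -/
theorem velocity_mem_modelTangent {β : E → E →L[ℝ] E →L[ℝ] ℝ} {γ : ℝ → E × (E →L[ℝ] E)}
    {w : E × (E →L[ℝ] E)} (hγ : HasDerivAt γ w 0) (hβ : DifferentiableAt ℝ β (γ 0).1)
    (hi : ∀ᶠ t in 𝓝 0, IsIsometricComplex (β (γ t).1) (γ t).2) {Γ : E →L[ℝ] E →L[ℝ] E}
    (hΓ : ∀ u v z, fderiv ℝ β (γ 0).1 u v z =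
      β (γ 0).1 (Γ u v) z + β (γ 0).1 v (Γ u z)) :
    w ∈ modelTangent (β (γ 0).1) Γ (γ 0).2 := by
  have hi0 : IsIsometricComplex (β (γ 0).1) (γ 0).2 := hi.self_of_nhds
  have hy : HasDerivAt (fun t => (γ t).1) w.1 0 :=
    (hasFDerivAt_fst (p := γ 0)).comp_hasDerivAt (0 : ℝ) hγ
  have ha : HasDerivAt (fun t => (γ t).2) w.2 0 :=
    (hasFDerivAt_snd (p := γ 0)).comp_hasDerivAt (0 : ℝ) hγ
  have hβy : HasDerivAt (fun t => β (γ t).1) (fderiv ℝ β (γ 0).1 w.1) 0 :=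
    hβ.hasFDerivAt.comp_hasDerivAt (0 : ℝ) hy
  have hanti : w.2 ∈ anticommEnd (γ 0).2 := by
    have h1 := ha.mul ha
    have h2 : HasDerivAt (fun t => (γ t).2 * (γ t).2) 0 0 :=
      (hasDerivAt_const (0 : ℝ) (-1 : E →L[ℝ] E)).congr_of_eventuallyEq (hi.mono fun t ht => ht.1)
    exact h1.unique h2
  rw [mem_modelTangent]
  refine ⟨add_mem hanti (commutator_mem_anticommEnd hi0.1 _), fun v z => ?_⟩
  have hav : ∀ v, HasDerivAt (fun t => (γ t).2 v) (w.2 v) 0 := fun v => by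
    simpa using ha.clm_apply (hasDerivAt_const (0 : ℝ) v)
  have h1 : HasDerivAt (fun t => β (γ t).1 ((γ t).2 v) z + β (γ t).1 v ((γ t).2 z)) _ 0 :=
    ((hβy.clm_apply (hav v)).clm_apply (hasDerivAt_const (0 : ℝ) z)).add
      ((hβy.clm_apply (hasDerivAt_const (0 : ℝ) v)).clm_apply (hav z))
  have h2 : HasDerivAt (fun t => β (γ t).1 ((γ t).2 v) z + β (γ t).1 v ((γ t).2 z)) 0 0 :=
    (hasDerivAt_const (0 : ℝ) (0 : ℝ)).congr_of_eventuallyEq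
      (hi.mono fun t ht => ht.mem_skewEnd v z)
  have h3 := h1.unique h2
  simp only [add_apply, map_zero, add_zero, hΓ] at h3
  have s1 := hi0.mem_skewEnd (Γ w.1 v) z
  have s2 := hi0.mem_skewEnd v (Γ w.1 z)
  obtain ⟨u, b⟩ := w
  rw [vertPart_apply]
  simp only [add_apply, sub_apply, end_mul_apply, map_add, map_sub]
  linear_combination h3 - s1 - s2

variable [FiniteDimensional ℝ E]

/-- The curve is the preimage, under the flattening map at $(y_0,a_0)$, of the straight line $t
\mapsto (y_0+tu,\,tB)$ in the flat model; $B$ is chosen to produce the prescribed velocity. -/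
theorem exists_curve_of_mem_modelTangent {U : Set E} {β : E → E →L[ℝ] E →L[ℝ] ℝ}
    (hU : IsOpen U) (hβ : ∀ y ∈ U, IsMetricForm (β y)) (hs : ContDiffOn ℝ ∞ β U)
    {y₀ : E} (hy₀ : y₀ ∈ U) {Γ : E →L[ℝ] E →L[ℝ] E}
    (hΓ : ∀ u v z, fderiv ℝ β y₀ u v z = β y₀ (Γ u v) z + β y₀ v (Γ u z))
    {a₀ : E →L[ℝ] E} (ha₀ : IsIsometricComplex (β y₀) a₀) {w : E × (E →L[ℝ] E)}
    (hw : w ∈ modelTangent (β y₀) Γ a₀) :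
    ∃ ε > 0, ∃ γ : ℝ → E × (E →L[ℝ] E), ContDiffOn ℝ ∞ γ (Set.Ioo (-ε) ε) ∧ γ 0 = (y₀, a₀) ∧
      HasDerivAt γ w 0 ∧ ∀ t ∈ Set.Ioo (-ε) ε, γ t ∈ isometricSet U β := by
  have : CompleteSpace E := FiniteDimensional.complete ℝ E
  obtain ⟨V, P, Q, hVo, hyV, hVU, hP, hQ, hP0, hPQ⟩ := exists_frame hU hβ hs hy₀
  obtain ⟨φ, hφs, -, -, hφ', hφ0, hφe, hφi⟩ :=
    exists_flattening (U := U) hVo hyV hVU hP hQ hP0 hPQ ha₀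
  obtain ⟨u, b⟩ := w
  have hQ0 : Q y₀ = 1 := by
    have h := (hPQ y₀ hyV).1
    rwa [hP0, one_mul] at h
  have hVn : V ∈ 𝓝 y₀ := hVo.mem_nhds hyV
  have hPd := ((hP.contDiffAt hVn).differentiableAt (by simp)).hasFDerivAt
  have hQd := ((hQ.contDiffAt hVn).differentiableAt (by simp)).hasFDerivAt
  have hβd := ((hs.contDiffAt (hU.mem_nhds hy₀)).differentiableAt (by simp)).hasFDerivAt
  have hl : HasDerivAt (fun t : ℝ => y₀ + t • u) u 0 := by
    simpa using ((hasDerivAt_id (0 : ℝ)).smul_const u).const_add y₀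
  have hl0 : y₀ + (0 : ℝ) • u = y₀ := by simp
  have hln : ∀ᶠ t in 𝓝 (0 : ℝ), y₀ + t • u ∈ V := by
    refine hl.continuousAt.eventually (p := fun y => y ∈ V) ?_
    rw [show (fun t : ℝ => y₀ + t • u) 0 = y₀ from hl0]
    exact hVn
  obtain ⟨P', hP'⟩ : ∃ P', P' = fderiv ℝ P y₀ u := ⟨_, rfl⟩
  have hPl : HasDerivAt (fun t : ℝ => P (y₀ + t • u)) P' 0 := by
    rw [hP']
    exact HasFDerivAt.comp_hasDerivAt (0 : ℝ) (by rw [hl0]; exact hPd) hl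
  have hβl : HasDerivAt (fun t : ℝ => β (y₀ + t • u)) (fderiv ℝ β y₀ u) 0 :=
    HasFDerivAt.comp_hasDerivAt (0 : ℝ) (by rw [hl0]; exact hβd) hl
  have hQl : HasDerivAt (fun t : ℝ => Q (y₀ + t • u)) (-P') 0 := by
    have h1 : HasDerivAt (fun t : ℝ => Q (y₀ + t • u)) (fderiv ℝ Q y₀ u) 0 :=
      HasFDerivAt.comp_hasDerivAt (0 : ℝ) (by rw [hl0]; exact hQd) hl
    have h2 := hPl.mul h1
    have h3 : HasDerivAt (fun t : ℝ => P (y₀ + t • u) * Q (y₀ + t • u)) 0 0 :=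
      (hasDerivAt_const (0 : ℝ) (1 : E →L[ℝ] E)).congr_of_eventuallyEq
        (hln.mono fun t ht => (hPQ _ ht).1)
    have h4 := h2.unique h3
    rw [hl0, hP0, hQ0, mul_one, one_mul] at h4
    rwa [← eq_neg_of_add_eq_zero_right h4]
  -- the frame is parallel up to a skew term
  have hskew : Γ u + P' ∈ skewEnd (β y₀) := by
    intro v z
    have hPv : ∀ v, HasDerivAt (fun t : ℝ => P (y₀ + t • u) v) (P' v) 0 := fun v => by
      simpa using hPl.clm_apply (hasDerivAt_const (0 : ℝ) v)
    have h1 := (hβl.clm_apply (hPv v)).clm_apply (hPv z)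
    have h2 : HasDerivAt (fun t : ℝ => β (y₀ + t • u) (P (y₀ + t • u) v) (P (y₀ + t • u) z)) 0 0 :=
      (hasDerivAt_const (0 : ℝ) (β y₀ v z)).congr_of_eventuallyEq
        (hln.mono fun t ht => (hPQ _ ht).2.2 v z)
    have h3 := h1.unique h2
    rw [hl0, hP0] at h3
    simp only [add_apply, one_apply_eq_self, hΓ, map_add] at h3 ⊢
    linear_combination h3
  -- The motion of the frame alone contributes $[P',a_0]$ to the velocity of $P(\cdot)Q$, since
  -- $Q'=-P'$; $b'$ is what the Cayley factor must supply. It is vertical because it differs from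
  -- the vertical part of $w$ by a commutator with the skew map $\Gamma_u+P'$.
  obtain ⟨b', hb'⟩ : ∃ b', b' = b - (P' * a₀ - a₀ * P') := ⟨_, rfl⟩
  have hb'e : b' = vertPart Γ a₀ (u, b) - ((Γ u + P') * a₀ - a₀ * (Γ u + P')) := by
    rw [hb', vertPart_apply, add_mul, mul_add]
    abel
  have hb'a : b' ∈ anticommEnd a₀ := by
    rw [hb'e]
    exact sub_mem hw.1 (commutator_mem_anticommEnd ha₀.1 _)
  have hb's : b' ∈ skewEnd (β y₀) := by
    rw [hb'e]
    exact sub_mem hw.2 (commutator_mem_skewEnd ha₀.mem_skewEnd hskew)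
  -- The Cayley factor $a_0(2(1-tB)^{-1}-1)$ has derivative $2a_0B$ at $0$, so $2a_0B=b'$ forces
  -- $B=-\tfrac12 a_0b'$.
  obtain ⟨B, hB⟩ : ∃ B, B = (-(1 / 2) : ℝ) • (a₀ * b') := ⟨_, rfl⟩
  have hBa : B ∈ anticommEnd a₀ := by
    rw [hB]
    exact Submodule.smul_mem _ _ (mul_mem_anticommEnd hb'a)
  have hBs : B ∈ skewEnd (β y₀) := by
    rw [hB]
    exact Submodule.smul_mem _ _ (mul_mem_skewEnd ha₀.mem_skewEnd hb's hb'a)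
  have haB : a₀ * ((2 : ℝ) • B) = b' := by
    rw [hB, smul_smul, mul_smul_comm, ← mul_assoc, ha₀.1]
    norm_num
  let l : ℝ → E × (E →L[ℝ] E) := fun t => (y₀ + t • u, t • B)
  have hlc : ContDiff ℝ ∞ l :=
    (contDiff_const.add (contDiff_id.smul contDiff_const)).prodMk (contDiff_id.smul contDiff_const)
  have hl0' : l 0 = φ (y₀, a₀) := by rw [hφ0]; simp [l]
  have hlt : ∀ᶠ t in 𝓝 (0 : ℝ), l t ∈ φ.target := by
    refine hlc.continuous.continuousAt.eventually (φ.open_target.mem_nhds ?_)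
    rw [hl0']
    exact φ.map_source hφs
  obtain ⟨ε, hε, hεt⟩ := Metric.eventually_nhds_iff_ball.1 hlt
  have hεt' : ∀ t ∈ Set.Ioo (-ε) ε, l t ∈ φ.target := fun t ht => hεt t (by
    rwa [Real.ball_eq_Ioo, zero_sub, zero_add])
  refine ⟨ε, hε, fun t => φ.symm (l t), hφ'.comp hlc.contDiffOn hεt', ?_, ?_, fun t ht => ?_⟩
  · change φ.symm (l 0) = _
    rw [hl0', φ.left_inv hφs]
  · have hinv : HasDerivAt (fun t : ℝ => Ring.inverse (1 - t • B)) B 0 := by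
      have h1 : HasDerivAt (fun t : ℝ => 1 - t • B) (-B) 0 := by
        simpa using ((hasDerivAt_id (0 : ℝ)).smul_const B).const_sub (1 : E →L[ℝ] E)
      have h2 := hasFDerivAt_ringInverse (𝕜 := ℝ) (1 : (E →L[ℝ] E)ˣ)
      have h3 := HasFDerivAt.comp_hasDerivAt (0 : ℝ) (f := fun t : ℝ => 1 - t • B)
        (l := Ring.inverse) (by simpa using h2) h1
      simpa using! h3
    have hm : HasDerivAt (fun t : ℝ => a₀ * ((2 : ℝ) • Ring.inverse (1 - t • B) - 1)) b' 0 := by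
      rw [← haB]
      exact ((hinv.const_smul (2 : ℝ)).sub_const 1).const_mul a₀
    have hfull := hl.prodMk ((hPl.mul hm).mul hQl)
    refine (hfull.congr_deriv ?_).congr_of_eventuallyEq (Eventually.of_forall fun t => hφe (l t))
    ext1
    · rfl
    · simp only [hP0, hQ0, zero_smul, add_zero, sub_zero, Ring.inverse_one, two_smul,
        add_sub_cancel_right, mul_one, one_mul, Pi.mul_apply]
      rw [hb']
      noncomm_ring
  · have ht' := hεt' t ht
    rw [hφi _ (φ.map_target ht'), φ.right_inv ht']
    exact ⟨trivial, Submodule.smul_mem _ _ hBa, Submodule.smul_mem _ _ hBs⟩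

end Velocity

/-! ### Coordinates on the manifold -/

section Coordinates

open Filter Topology

variable {E : Type*} [NormedAddCommGroup E] [NormedSpace ℝ E]
  {M : Type*} [TopologicalSpace M] [ChartedSpace E M] [IsManifold 𝓘(ℝ, E) ∞ M]

/-- The coordinate expression, in the chart at `x₀`, of the tangent vectors at `x`. -/
def tr (x₀ x : M) : TangentSpace 𝓘(ℝ, E) x →L[ℝ] E :=
  (trivializationAt E (TangentSpace 𝓘(ℝ, E)) x₀).continuousLinearMapAt ℝ x

/-- The tangent vector at `x` with given coordinate expression in the chart at `x₀`. -/
def trInv (x₀ x : M) : E →L[ℝ] TangentSpace 𝓘(ℝ, E) x :=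
  (trivializationAt E (TangentSpace 𝓘(ℝ, E)) x₀).symmL ℝ x

variable {x₀ x : M}

theorem tr_trInv (hx : x ∈ (chartAt E x₀).source) (v : E) : tr x₀ x (trInv x₀ x v) = v :=
  (trivializationAt E (TangentSpace 𝓘(ℝ, E)) x₀).continuousLinearMapAt_symmL hx v

theorem trInv_tr (hx : x ∈ (chartAt E x₀).source) (v : TangentSpace 𝓘(ℝ, E) x) :
    trInv x₀ x (tr x₀ x v) = v :=
  (trivializationAt E (TangentSpace 𝓘(ℝ, E)) x₀).symmL_continuousLinearMapAt hx v

theorem hasMFDerivAt_extChartAt_tr (hx : x ∈ (chartAt E x₀).source) :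
    HasMFDerivAt 𝓘(ℝ, E) 𝓘(ℝ, E) (extChartAt 𝓘(ℝ, E) x₀) x (tr x₀ x) := by
  have h := (mdifferentiableAt_extChartAt (I := 𝓘(ℝ, E)) hx).hasMFDerivAt
  rwa [← TangentBundle.continuousLinearMapAt_trivializationAt (I := 𝓘(ℝ, E)) hx] at h

theorem hasMFDerivAt_of_coord {F : Type*} [NormedAddCommGroup F] [NormedSpace ℝ F] {f : M → F}
    (hx : x ∈ (chartAt E x₀).source) (hf : MDifferentiableAt 𝓘(ℝ, E) 𝓘(ℝ, F) f x) :
    DifferentiableAt ℝ (f ∘ (extChartAt 𝓘(ℝ, E) x₀).symm) (extChartAt 𝓘(ℝ, E) x₀ x) ∧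
    HasMFDerivAt 𝓘(ℝ, E) 𝓘(ℝ, F) f x
      (fderiv ℝ (f ∘ (extChartAt 𝓘(ℝ, E) x₀).symm) (extChartAt 𝓘(ℝ, E) x₀ x) ∘L tr x₀ x) := by
  have hx' : x ∈ (extChartAt 𝓘(ℝ, E) x₀).source := by rwa [extChartAt_source]
  have hm := (extChartAt 𝓘(ℝ, E) x₀).map_source hx'
  have hxe := (extChartAt 𝓘(ℝ, E) x₀).left_inv hx'
  have h := (mdifferentiableWithinAt_extChartAt_symm (I := 𝓘(ℝ, E)) hm)
  rw [modelWithCornersSelf_coe, Set.range_id, mdifferentiableWithinAt_univ] at h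
  have h1 : DifferentiableAt ℝ (f ∘ (extChartAt 𝓘(ℝ, E) x₀).symm) (extChartAt 𝓘(ℝ, E) x₀ x) := by
    rw [← mdifferentiableAt_iff_differentiableAt]
    refine MDifferentiableAt.comp _ ?_ h
    rwa [hxe]
  refine ⟨h1, ?_⟩
  have h2 := HasMFDerivAt.comp x h1.hasFDerivAt.hasMFDerivAt (hasMFDerivAt_extChartAt_tr hx)
  refine h2.congr_of_eventuallyEq ?_
  filter_upwards [(chartAt E x₀).open_source.mem_nhds hx] with z hz
  have hz' : z ∈ (extChartAt 𝓘(ℝ, E) x₀).source := by rwa [extChartAt_source]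
  simp only [Function.comp_apply, (extChartAt 𝓘(ℝ, E) x₀).left_inv hz']

/-- The coordinate expression of a vector field in the chart at `x₀`. -/
def coordField (x₀ : M) (σ : Π x : M, TangentSpace 𝓘(ℝ, E) x) : E → E :=
  fun y => tr x₀ ((extChartAt 𝓘(ℝ, E) x₀).symm y) (σ ((extChartAt 𝓘(ℝ, E) x₀).symm y))

theorem coordField_extChartAt (hx : x ∈ (chartAt E x₀).source)
    (σ : Π x : M, TangentSpace 𝓘(ℝ, E) x) :
    coordField x₀ σ (extChartAt 𝓘(ℝ, E) x₀ x) = tr x₀ x (σ x) := by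
  have hx' : x ∈ (extChartAt 𝓘(ℝ, E) x₀).source := by rwa [extChartAt_source]
  rw [coordField, (extChartAt 𝓘(ℝ, E) x₀).left_inv hx']

theorem mdifferentiableAt_section_iff_tr (hx : x ∈ (chartAt E x₀).source)
    (σ : Π x : M, TangentSpace 𝓘(ℝ, E) x) :
    MDifferentiableAt 𝓘(ℝ, E) (𝓘(ℝ, E).prod 𝓘(ℝ, E))
      (fun x => (⟨x, σ x⟩ : TangentBundle 𝓘(ℝ, E) M)) x ↔
    MDifferentiableAt 𝓘(ℝ, E) 𝓘(ℝ, E) (fun x => tr x₀ x (σ x)) x := by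
  rw [(trivializationAt E (TangentSpace 𝓘(ℝ, E)) x₀).mdifferentiableAt_section_iff 𝓘(ℝ, E) σ hx]
  refine Filter.EventuallyEq.mdifferentiableAt_iff ?_
  filter_upwards [(chartAt E x₀).open_source.mem_nhds hx] with z hz
  exact ((trivializationAt E (TangentSpace 𝓘(ℝ, E)) x₀).continuousLinearMapAt_apply_of_mem ℝ hz
    (σ z)).symm

theorem differentiableAt_coordField (hx : x ∈ (chartAt E x₀).source)
    {σ : Π x : M, TangentSpace 𝓘(ℝ, E) x}
    (hσ : MDifferentiableAt 𝓘(ℝ, E) (𝓘(ℝ, E).prod 𝓘(ℝ, E))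
      (fun x => (⟨x, σ x⟩ : TangentBundle 𝓘(ℝ, E) M)) x) :
    DifferentiableAt ℝ (coordField x₀ σ) (extChartAt 𝓘(ℝ, E) x₀ x) :=
  (hasMFDerivAt_of_coord hx ((mdifferentiableAt_section_iff_tr hx σ).1 hσ)).1

/-- The vector field that is constant in the chart at `x₀`. -/
def constField (x₀ : M) (v : E) (x : M) : TangentSpace 𝓘(ℝ, E) x := trInv x₀ x v

theorem mdifferentiableAt_constField (hx : x ∈ (chartAt E x₀).source) (v : E) :
    MDifferentiableAt 𝓘(ℝ, E) (𝓘(ℝ, E).prod 𝓘(ℝ, E))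
      (fun x => (⟨x, constField x₀ v x⟩ : TangentBundle 𝓘(ℝ, E) M)) x := by
  rw [mdifferentiableAt_section_iff_tr hx]
  refine (mdifferentiableAt_const (c := v)).congr_of_eventuallyEq ?_
  filter_upwards [(chartAt E x₀).open_source.mem_nhds hx] with z hz
  exact tr_trInv hz v

/-- The flat connection of the chart at `x₀`. -/
def flatConnection (x₀ : M) (σ : Π x : M, TangentSpace 𝓘(ℝ, E) x) (x : M) :
    TangentSpace 𝓘(ℝ, E) x →L[ℝ] TangentSpace 𝓘(ℝ, E) x :=
  trInv x₀ x ∘L fderiv ℝ (coordField x₀ σ) (extChartAt 𝓘(ℝ, E) x₀ x) ∘L tr x₀ x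

/-- Provides the reference point for Christoffel symbols: a connection differs from the flat one of
a chart by a tensor on the chart domain, and that tensor is `connSymbol`. -/
theorem isCovariantDerivativeOn_flatConnection (x₀ : M) :
    IsCovariantDerivativeOn E (flatConnection (E := E) x₀) (chartAt E x₀).source where
  add {σ σ' x} hσ hσ' hx := by
    have h : coordField x₀ (σ + σ') = coordField x₀ σ + coordField x₀ σ' := by
      ext y
      exact map_add (tr x₀ _) _ _
    rw [flatConnection, h, fderiv_add (differentiableAt_coordField hx hσ)
      (differentiableAt_coordField hx hσ')]
    ext v
    simp [flatConnection]
  leibniz {σ g x} hσ hg hx := by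
    obtain ⟨h1, h2⟩ := hasMFDerivAt_of_coord hx hg
    have h : coordField x₀ (g • σ) = fun y => (g ∘ (extChartAt 𝓘(ℝ, E) x₀).symm) y •
        coordField x₀ σ y := by
      ext y
      exact map_smul (tr x₀ _) _ _
    have hx' : x ∈ (extChartAt 𝓘(ℝ, E) x₀).source := by rwa [extChartAt_source]
    rw [flatConnection, h, fderiv_fun_smul h1 (differentiableAt_coordField hx hσ)]
    ext v
    have hd : mvfderiv 𝓘(ℝ, E) g x v =
        fderiv ℝ (g ∘ (extChartAt 𝓘(ℝ, E) x₀).symm) (extChartAt 𝓘(ℝ, E) x₀ x) (tr x₀ x v) := by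
      rw [mvfderiv, h2.mfderiv]
      rfl
    change trInv x₀ x ((g ∘ (extChartAt 𝓘(ℝ, E) x₀).symm) (extChartAt 𝓘(ℝ, E) x₀ x) • _ +
      fderiv ℝ (g ∘ (extChartAt 𝓘(ℝ, E) x₀).symm) (extChartAt 𝓘(ℝ, E) x₀ x) (tr x₀ x v) •
        coordField x₀ σ (extChartAt 𝓘(ℝ, E) x₀ x)) = g x • _ + mvfderiv 𝓘(ℝ, E) g x v • σ x
    rw [map_add, map_smul, map_smul, coordField_extChartAt hx, trInv_tr hx, hd,
      Function.comp_apply, (extChartAt 𝓘(ℝ, E) x₀).left_inv hx']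
    rfl

end Coordinates

/-! ### The natural almost complex structure in coordinates -/

section EndCoordinates

open Filter Topology

variable {E : Type*} [NormedAddCommGroup E] [NormedSpace ℝ E]
  {M : Type*} [TopologicalSpace M] [ChartedSpace E M] [IsManifold 𝓘(ℝ, E) ∞ M]

/-- The coordinate expression, in the chart at `x₀`, of an endomorphism of the tangent space at
`x`. -/
def trEnd (x₀ x : M) (A : EndFiber E x) : E →L[ℝ] E := tr x₀ x ∘L A ∘L trInv x₀ x

theorem trEnd_apply (x₀ x : M) (A : EndFiber E x) (v : E) :
    trEnd x₀ x A v = tr x₀ x (A (trInv x₀ x v)) := rfl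

theorem trEnd_apply_constField (x₀ x : M) (A : EndFiber E x) (v : E) :
    trEnd x₀ x A v = tr x₀ x (A (constField x₀ v x)) := rfl

theorem trEnd_tr {x₀ x : M} (hx : x ∈ (chartAt E x₀).source) (A : EndFiber E x)
    (X : TangentSpace 𝓘(ℝ, E) x) : trEnd x₀ x A (tr x₀ x X) = tr x₀ x (A X) := by
  rw [trEnd_apply, trInv_tr hx]

theorem trEnd_comp {x₀ x : M} (hx : x ∈ (chartAt E x₀).source) (A B : EndFiber E x) :
    trEnd x₀ x (A ∘L B) = trEnd x₀ x A * trEnd x₀ x B := by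
  ext v
  rw [end_mul_apply, trEnd_apply x₀ x B, trEnd_tr hx]
  rfl

theorem chart_endBundle_source {q₀ q : EndBundle E M} :
    q ∈ (chartAt (ModelProd E (E →L[ℝ] E)) q₀).source ↔ q.1 ∈ (chartAt E q₀.1).source := by
  simp only [FiberBundle.chartedSpace_chartAt, mfld_simps]
  exact and_iff_right_of_imp fun h => h

theorem extChartAt_endBundle (q₀ q : EndBundle E M) :
    extChartAt (endModel E) q₀ q = (extChartAt 𝓘(ℝ, E) q₀.1 q.1, trEnd q₀.1 q.1 q.2) := by
  change chartAt (ModelProd E (E →L[ℝ] E)) q₀ q = _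
  rw [hom_chart]
  rfl

theorem chart_endBundle_target {q₀ : EndBundle E M} {w : E × (E →L[ℝ] E)} :
    w ∈ (chartAt (ModelProd E (E →L[ℝ] E)) q₀).target ↔ w.1 ∈ (chartAt E q₀.1).target := by
  simp only [FiberBundle.chartedSpace_chartAt, mfld_simps]
  exact and_iff_left_of_imp fun h => (chartAt E q₀.1).map_target h

theorem extChartAt_endBundle_target (q₀ : EndBundle E M) :
    (extChartAt (endModel E) q₀).target = (chartAt (ModelProd E (E →L[ℝ] E)) q₀).target := by
  simp only [extChartAt_target, modelWithCornersSelf_coe_symm, modelWithCorners_prod_coe_symm,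
    modelWithCorners_prod_coe, modelWithCornersSelf_coe, Prod.map_id, Set.range_id,
    Set.inter_univ, Set.preimage_id]

/-- The coordinate expression of the tangent vectors to `End(TM)`. -/
def trN (q₀ q : EndBundle E M) : TangentSpace (endModel E) q →L[ℝ] E × (E →L[ℝ] E) :=
  (trivializationAt (E × (E →L[ℝ] E)) (TangentSpace (endModel E)) q₀).continuousLinearMapAt ℝ q

/-- The tangent vector to `End(TM)` with given coordinate expression. -/
def trNInv (q₀ q : EndBundle E M) : E × (E →L[ℝ] E) →L[ℝ] TangentSpace (endModel E) q :=
  (trivializationAt (E × (E →L[ℝ] E)) (TangentSpace (endModel E)) q₀).symmL ℝ q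

variable {q₀ q : EndBundle E M}

theorem mem_trivializationAt_endBundle (hq : q.1 ∈ (chartAt E q₀.1).source) :
    q ∈ (trivializationAt (E × (E →L[ℝ] E)) (TangentSpace (endModel E)) q₀).baseSet := by
  rw [TangentBundle.trivializationAt_baseSet, chart_endBundle_source]
  exact hq

theorem trN_trNInv (hq : q.1 ∈ (chartAt E q₀.1).source) (w : E × (E →L[ℝ] E)) :
    trN q₀ q (trNInv q₀ q w) = w :=
  (trivializationAt (E × (E →L[ℝ] E)) (TangentSpace (endModel E)) q₀).continuousLinearMapAt_symmL
    (mem_trivializationAt_endBundle hq) w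

theorem trNInv_trN (hq : q.1 ∈ (chartAt E q₀.1).source) (w : TangentSpace (endModel E) q) :
    trNInv q₀ q (trN q₀ q w) = w :=
  (trivializationAt (E × (E →L[ℝ] E)) (TangentSpace (endModel E)) q₀).symmL_continuousLinearMapAt
    (mem_trivializationAt_endBundle hq) w

theorem hasMFDerivAt_extChartAt_trN (hq : q.1 ∈ (chartAt E q₀.1).source) :
    HasMFDerivAt (endModel E) 𝓘(ℝ, E × (E →L[ℝ] E)) (extChartAt (endModel E) q₀) q (trN q₀ q) := by
  have hq' := chart_endBundle_source.2 hq
  have h := (mdifferentiableAt_extChartAt (I := endModel E) hq').hasMFDerivAt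
  rwa [← TangentBundle.continuousLinearMapAt_trivializationAt (I := endModel E) hq'] at h

theorem trN_verticalLift (hq : q.1 ∈ (chartAt E q₀.1).source) (B : EndFiber E q.1) :
    trN q₀ q (verticalLift q B) = (0, trEnd q₀.1 q.1 B) := by
  have h1 := HasMFDerivAt.comp (f := fun A : E →L[ℝ] E => (⟨q.1, A⟩ : EndBundle E M)) _
    (hasMFDerivAt_extChartAt_trN hq) (hasMFDerivAt_fiber_inclusion q)
  let t : E →L[ℝ] E := tr q₀.1 q.1
  let t' : E →L[ℝ] E := trInv q₀.1 q.1
  let L : (E →L[ℝ] E) →L[ℝ] (E →L[ℝ] E) :=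
    (ContinuousLinearMap.compL ℝ E E E t) ∘L ((ContinuousLinearMap.compL ℝ E E E).flip t')
  have h2 : HasFDerivAt (fun A : E →L[ℝ] E => (extChartAt 𝓘(ℝ, E) q₀.1 q.1, L A))
      ((0 : (E →L[ℝ] E) →L[ℝ] E).prod L) q.2 :=
    (hasFDerivAt_const _ _).prodMk L.hasFDerivAt
  have h3 : (extChartAt (endModel E) q₀) ∘ (fun A : E →L[ℝ] E => (⟨q.1, A⟩ : EndBundle E M)) =
      fun A : E →L[ℝ] E => (extChartAt 𝓘(ℝ, E) q₀.1 q.1, L A) := by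
    funext A
    rw [Function.comp_apply, extChartAt_endBundle]
    rfl
  rw [h3] at h1
  exact congrArg (fun f => f B) (hasMFDerivAt_unique h1 h2.hasMFDerivAt)

/-- The coordinate expression of a section of `End(TM)` in the chart at `x₀`. -/
def coordEndField (x₀ : M) (s : Π x : M, EndFiber E x) (y : E) : E →L[ℝ] E :=
  trEnd x₀ ((extChartAt 𝓘(ℝ, E) x₀).symm y) (s ((extChartAt 𝓘(ℝ, E) x₀).symm y))

/-- In the chart the section is the graph $y \mapsto (y, s(y))$. -/
theorem trN_mfderiv_section {x : M} (s : Π x : M, EndFiber E x)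
    (hx : x ∈ (chartAt E q₀.1).source)
    (hs : MDifferentiableAt 𝓘(ℝ, E) (endModel E) (fun y => (⟨y, s y⟩ : EndBundle E M)) x) :
    DifferentiableAt ℝ (coordEndField q₀.1 s) (extChartAt 𝓘(ℝ, E) q₀.1 x) ∧
    ∀ X, trN q₀ ⟨x, s x⟩ (mfderiv 𝓘(ℝ, E) (endModel E) (fun y => (⟨y, s y⟩ : EndBundle E M)) x X) =
      (tr q₀.1 x X, fderiv ℝ (coordEndField q₀.1 s) (extChartAt 𝓘(ℝ, E) q₀.1 x) (tr q₀.1 x X)) := by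
  let f : M → E × (E →L[ℝ] E) := fun y => extChartAt (endModel E) q₀ (⟨y, s y⟩ : EndBundle E M)
  have h1 : HasMFDerivAt 𝓘(ℝ, E) 𝓘(ℝ, E × (E →L[ℝ] E)) f x
      (trN q₀ ⟨x, s x⟩ ∘L
        mfderiv 𝓘(ℝ, E) (endModel E) (fun y => (⟨y, s y⟩ : EndBundle E M)) x) :=
    HasMFDerivAt.comp (f := fun y => (⟨y, s y⟩ : EndBundle E M)) x
      (hasMFDerivAt_extChartAt_trN (q := ⟨x, s x⟩) hx) hs.hasMFDerivAt
  obtain ⟨h2, h3⟩ := hasMFDerivAt_of_coord hx h1.mdifferentiableAt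
  have hx' : x ∈ (extChartAt 𝓘(ℝ, E) q₀.1).source := by rwa [extChartAt_source]
  have hm := (extChartAt 𝓘(ℝ, E) q₀.1).map_source hx'
  have h4 : f ∘ (extChartAt 𝓘(ℝ, E) q₀.1).symm =ᶠ[𝓝 (extChartAt 𝓘(ℝ, E) q₀.1 x)]
      fun y => (y, coordEndField q₀.1 s y) := by
    filter_upwards [(isOpen_extChartAt_target q₀.1).mem_nhds hm] with y hy
    simp only [f, Function.comp_apply, extChartAt_endBundle,
      (extChartAt 𝓘(ℝ, E) q₀.1).right_inv hy]
    rfl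
  have h5 := h2.congr_of_eventuallyEq h4.symm
  have h6 : DifferentiableAt ℝ (coordEndField q₀.1 s) (extChartAt 𝓘(ℝ, E) q₀.1 x) := h5.snd
  refine ⟨h6, fun X => ?_⟩
  have h7 : fderiv ℝ (f ∘ (extChartAt 𝓘(ℝ, E) q₀.1).symm) (extChartAt 𝓘(ℝ, E) q₀.1 x) =
      (ContinuousLinearMap.id ℝ E).prod
        (fderiv ℝ (coordEndField q₀.1 s) (extChartAt 𝓘(ℝ, E) q₀.1 x)) := by
    rw [h4.fderiv_eq]
    exact ((hasFDerivAt_id _).prodMk h6.hasFDerivAt).fderiv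
  exact (congrArg (fun f => f X) (hasMFDerivAt_unique h1 h3)).trans
    (congrArg (fun f : E →L[ℝ] E × (E →L[ℝ] E) => f (tr q₀.1 x X)) h7)

theorem trN_sectionThroughDeriv (hq : q.1 ∈ (chartAt E q₀.1).source)
    (X : TangentSpace 𝓘(ℝ, E) q.1) :
    trN q₀ q (sectionThroughDeriv q X) = (tr q₀.1 q.1 X,
      fderiv ℝ (coordEndField q₀.1 (sectionThrough q)) (extChartAt 𝓘(ℝ, E) q₀.1 q.1)
        (tr q₀.1 q.1 X)) := by
  have h := (trN_mfderiv_section (q₀ := q₀) (sectionThrough q) hq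
    (sectionThrough_mdifferentiableAt q)).2 X
  rw [sectionThrough_self] at h
  exact h

theorem coordField_constField_eventuallyEq {x₀ x : M} (hx : x ∈ (chartAt E x₀).source) (v : E) :
    coordField x₀ (constField x₀ v) =ᶠ[𝓝 (extChartAt 𝓘(ℝ, E) x₀ x)] fun _ => v := by
  have hx' : x ∈ (extChartAt 𝓘(ℝ, E) x₀).source := by rwa [extChartAt_source]
  have hm := (extChartAt 𝓘(ℝ, E) x₀).map_source hx'
  filter_upwards [(isOpen_extChartAt_target x₀).mem_nhds hm] with y hy
  refine tr_trInv ?_ v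
  have := (extChartAt 𝓘(ℝ, E) x₀).map_target hy
  rwa [extChartAt_source] at this

theorem trN_injective (hq : q.1 ∈ (chartAt E q₀.1).source) : Function.Injective (trN q₀ q) :=
  Function.LeftInverse.injective (trNInv_trN hq)

variable [FiniteDimensional ℝ E]

/-- The Christoffel symbol at `x` of a linear connection in the chart at `x₀`. -/
def connSymbol (D : LinearConnection E M) (x₀ x : M) : E →L[ℝ] E →L[ℝ] E :=
  (LinearMap.mk₂ ℝ (fun u v => tr x₀ x (D.isCovariantDerivativeOn.difference
      (isCovariantDerivativeOn_flatConnection x₀) x (trInv x₀ x v) (trInv x₀ x u)))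
    (fun u u' v => by simp only [map_add])
    (fun c u v => by simp only [map_smul])
    (fun u v v' => by simp only [map_add, add_apply])
    (fun c u v => by simp only [map_smul, smul_apply])).toContinuousBilinearMap

theorem tr_connection (D : LinearConnection E M) {x₀ x : M} (hx : x ∈ (chartAt E x₀).source)
    {σ : Π x : M, TangentSpace 𝓘(ℝ, E) x}
    (hσ : MDifferentiableAt 𝓘(ℝ, E) (𝓘(ℝ, E).prod 𝓘(ℝ, E))
      (fun x => (⟨x, σ x⟩ : TangentBundle 𝓘(ℝ, E) M)) x) (X : TangentSpace 𝓘(ℝ, E) x) :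
    tr x₀ x (D σ x X) = fderiv ℝ (coordField x₀ σ) (extChartAt 𝓘(ℝ, E) x₀ x) (tr x₀ x X) +
      connSymbol D x₀ x (tr x₀ x X) (tr x₀ x (σ x)) := by
  have h := IsCovariantDerivativeOn.difference_apply (D.isCovariantDerivativeOn)
    (isCovariantDerivativeOn_flatConnection x₀) hx hσ
  have h1 : connSymbol D x₀ x (tr x₀ x X) (tr x₀ x (σ x)) =
      tr x₀ x (D.isCovariantDerivativeOn.difference (isCovariantDerivativeOn_flatConnection x₀) x
        (trInv x₀ x (tr x₀ x (σ x))) (trInv x₀ x (tr x₀ x X))) := rfl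
  rw [h1, trInv_tr hx, trInv_tr hx, h, sub_apply, map_sub]
  have h2 : tr x₀ x (flatConnection x₀ σ x X) =
      fderiv ℝ (coordField x₀ σ) (extChartAt 𝓘(ℝ, E) x₀ x) (tr x₀ x X) := tr_trInv hx _
  rw [h2, add_sub_cancel]

theorem tr_connection_constField (D : LinearConnection E M) {x₀ x : M}
    (hx : x ∈ (chartAt E x₀).source) (v : E) (X : TangentSpace 𝓘(ℝ, E) x) :
    tr x₀ x (D (constField x₀ v) x X) = connSymbol D x₀ x (tr x₀ x X) v := by
  rw [tr_connection D hx (mdifferentiableAt_constField hx v),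
    (coordField_constField_eventuallyEq hx v).fderiv_eq, fderiv_const_apply]
  rw [constField, tr_trInv hx, zero_apply, zero_add]

/-- `endDeriv` is built from one chosen extension of a vector; tensoriality allows any
differentiable field instead, in particular a coordinate field. -/
theorem endDeriv_apply (D : LinearConnection E M) {x : M} (s : Π x : M, EndFiber E x)
    (hs : MDifferentiableAt 𝓘(ℝ, E) (endModel E) (fun y => (⟨y, s y⟩ : EndBundle E M)) x)
    (X : TangentSpace 𝓘(ℝ, E) x) {Y : Π x : M, TangentSpace 𝓘(ℝ, E) x}
    (hY : MDifferentiableAt 𝓘(ℝ, E) (𝓘(ℝ, E).prod 𝓘(ℝ, E))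
      (fun x => (⟨x, Y x⟩ : TangentBundle 𝓘(ℝ, E) M)) x) :
    endDeriv D s x hs X (Y x) = D (fun y => s y (Y y)) x X - s x (D Y x X) := by
  have h := endDeriv_tensorial D s x hs X
  exact h.pointwise (σ := FiberBundle.extend E (Y x)) (σ' := Y)
    (FiberBundle.mdifferentiableAt_extend ..) hY (by simp)

/-- The formula $\nabla_X s = ds(X) + [\Gamma_X, s]$, tested on fields that are constant in the
chart. -/
theorem trEnd_endDeriv (D : LinearConnection E M) {x : M} (s : Π x : M, EndFiber E x)
    (hx : x ∈ (chartAt E q₀.1).source)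
    (hs : MDifferentiableAt 𝓘(ℝ, E) (endModel E) (fun y => (⟨y, s y⟩ : EndBundle E M)) x)
    (X : TangentSpace 𝓘(ℝ, E) x) :
    trEnd q₀.1 x (endDeriv D s x hs X) =
      fderiv ℝ (coordEndField q₀.1 s) (extChartAt 𝓘(ℝ, E) q₀.1 x) (tr q₀.1 x X) +
        (connSymbol D q₀.1 x (tr q₀.1 x X) * trEnd q₀.1 x (s x) -
          trEnd q₀.1 x (s x) * connSymbol D q₀.1 x (tr q₀.1 x X)) := by
  have hd := (trN_mfderiv_section (q₀ := q₀) s hx hs).1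
  refine ContinuousLinearMap.ext fun v => ?_
  have hY := mdifferentiableAt_constField hx v
  have h1 : endDeriv D s x hs X (constField q₀.1 v x) =
      D (fun y => s y (constField q₀.1 v y)) x X - s x (D (constField q₀.1 v) x X) :=
    endDeriv_apply D s hs X hY
  have h2 : fderiv ℝ (coordField q₀.1 (fun y => s y (constField q₀.1 v y)))
      (extChartAt 𝓘(ℝ, E) q₀.1 x) (tr q₀.1 x X) =
      fderiv ℝ (coordEndField q₀.1 s) (extChartAt 𝓘(ℝ, E) q₀.1 x) (tr q₀.1 x X) v :=
    by
    have h := hd.hasFDerivAt.clm_apply (hasFDerivAt_const v (extChartAt 𝓘(ℝ, E) q₀.1 x))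
    have h' : fderiv ℝ (coordField q₀.1 (fun y => s y (constField q₀.1 v y)))
      (extChartAt 𝓘(ℝ, E) q₀.1 x) = _ := h.fderiv
    rw [h']
    simp only [ContinuousLinearMap.comp_zero, zero_add, ContinuousLinearMap.flip_apply]
  have h3 : tr q₀.1 x (s x (D (constField q₀.1 v) x X)) =
      trEnd q₀.1 x (s x) (connSymbol D q₀.1 x (tr q₀.1 x X) v) := by
    rw [← trEnd_tr hx, tr_connection_constField D hx]
  have h4 := tr_connection D hx (σ := fun y => s y (constField q₀.1 v y))
    (MDifferentiableAt.clm_bundle_apply hs hY) X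
  have h5 : tr q₀.1 x (s x (constField q₀.1 v x)) = trEnd q₀.1 x (s x) v := rfl
  rw [h2, h5] at h4
  have h6 : trEnd q₀.1 x (endDeriv D s x hs X) v =
      tr q₀.1 x (D (fun y => s y (constField q₀.1 v y)) x X) -
        tr q₀.1 x (s x (D (constField q₀.1 v) x X)) :=
    by rw [trEnd_apply_constField, h1, map_sub]
  rw [h6, h3, h4, add_apply, sub_apply, end_mul_apply, end_mul_apply, add_sub_assoc]

/-- The derivative of the auxiliary section cancels, leaving $-[\Gamma_u,a]$: horizontal vectors are
those with zero `vertPart`. -/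
theorem trN_horizontalLift (D : LinearConnection E M) (hq : q.1 ∈ (chartAt E q₀.1).source)
    (X : TangentSpace 𝓘(ℝ, E) q.1) :
    trN q₀ q (horizontalLift D q X) = (tr q₀.1 q.1 X,
      -(connSymbol D q₀.1 q.1 (tr q₀.1 q.1 X) * trEnd q₀.1 q.1 q.2 -
          trEnd q₀.1 q.1 q.2 * connSymbol D q₀.1 q.1 (tr q₀.1 q.1 X))) := by
  have h : horizontalLift D q X = sectionThroughDeriv q X - verticalLift q
      (endDeriv D (sectionThrough q) q.1 (sectionThrough_mdifferentiableAt q) X) := rfl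
  have hs : sectionThrough q q.1 = q.2 := by simp [sectionThrough]
  rw [h, map_sub, trN_sectionThroughDeriv hq, trN_verticalLift hq, trEnd_endDeriv D _ hq, hs]
  ext1
  · exact sub_zero _
  · simp only [Prod.snd_sub]
    abel

/-- The bridge between geometry and `modelJ`, valid throughout the chart domain and not only at its
centre. Both sides act as multiplication by $a$ on base and vertical parts. -/
theorem trN_naturalComplexStructure (D : LinearConnection E M)
    (hq : q.1 ∈ (chartAt E q₀.1).source) (w : TangentSpace (endModel E) q) :
    trN q₀ q (naturalComplexStructure D q w) =
      modelJ (connSymbol D q₀.1 q.1) (trEnd q₀.1 q.1 q.2) (trN q₀ q w) := by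
  obtain ⟨⟨X, B⟩, rfl⟩ := (splitting D q).surjective w
  rw [splitting_apply, naturalComplexStructure_apply, map_add, map_add, trN_horizontalLift D hq,
    trN_horizontalLift D hq, trN_verticalLift hq, trN_verticalLift hq]
  apply ext_vertPart (Γ := connSymbol D q₀.1 q.1) (a := trEnd q₀.1 q.1 q.2)
  · rw [modelJ_fst]
    simp only [Prod.fst_add, add_zero, trEnd_tr hq]
  · rw [vertPart_modelJ]
    simp only [Prod.mk_add_mk, add_zero, vertPart_apply, trEnd_comp hq]
    noncomm_ring

end EndCoordinates

/-! ### Levi-Civita connections in coordinates -/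

section LeviCivita

open Filter Topology

variable {E : Type*} [NormedAddCommGroup E] [NormedSpace ℝ E]
  {M : Type*} [TopologicalSpace M] [ChartedSpace E M]

theorem extChartAt_symm_mem {x₀ : M} {y : E} (hy : y ∈ (extChartAt 𝓘(ℝ, E) x₀).target) :
    (extChartAt 𝓘(ℝ, E) x₀).symm y ∈ (chartAt E x₀).source := by
  have := (extChartAt 𝓘(ℝ, E) x₀).map_target hy
  rwa [extChartAt_source] at this

variable [IsManifold 𝓘(ℝ, E) ∞ M]

theorem contMDiffAt_constField {x₀ x : M} (hx : x ∈ (chartAt E x₀).source) (v : E) :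
    ContMDiffAt 𝓘(ℝ, E) (𝓘(ℝ, E).prod 𝓘(ℝ, E)) ∞
      (fun x => (⟨x, constField x₀ v x⟩ : TangentBundle 𝓘(ℝ, E) M)) x := by
  rw [(trivializationAt E (TangentSpace 𝓘(ℝ, E)) x₀).contMDiffAt_section_iff hx]
  refine (contMDiffAt_const (c := v)).congr_of_eventuallyEq ?_
  filter_upwards [(chartAt E x₀).open_source.mem_nhds hx] with z hz
  exact ((trivializationAt E (TangentSpace 𝓘(ℝ, E)) x₀).continuousLinearMapAt_apply_of_mem ℝ hz
    _).symm.trans (tr_trInv hz v)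

/-- A constant vector field on a vector space. -/
def constVectorField (v : E) (y : E) : TangentSpace 𝓘(ℝ, E) y := v

/-- Presents coordinate fields as pullbacks of constant fields, so that naturality of the Lie
bracket makes them commute. -/
theorem constField_eventuallyEq_mpullback {x₀ x : M} (hx : x ∈ (chartAt E x₀).source) (v : E) :
    constField x₀ v =ᶠ[𝓝 x] VectorField.mpullback 𝓘(ℝ, E) 𝓘(ℝ, E) (extChartAt 𝓘(ℝ, E) x₀)
      (constVectorField v) := by
  filter_upwards [(chartAt E x₀).open_source.mem_nhds hx] with z hz
  rw [VectorField.mpullback_apply, (hasMFDerivAt_extChartAt_tr hz).mfderiv]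
  let L : TangentSpace 𝓘(ℝ, E) z ≃L[ℝ] E :=
    ContinuousLinearEquiv.equivOfInverse (tr x₀ z) (trInv x₀ z) (trInv_tr hz) (tr_trInv hz)
  have h : (L : TangentSpace 𝓘(ℝ, E) z →L[ℝ] E).inverse = L.symm :=
    ContinuousLinearMap.inverse_equiv L
  exact (congrArg (fun f => f v) h).symm

theorem mlieBracket_constVectorField (v w : E) (y : E) :
    VectorField.mlieBracket 𝓘(ℝ, E) (constVectorField v) (constVectorField w) y = 0 := by
  rw [← VectorField.mlieBracketWithin_univ, VectorField.mlieBracketWithin_eq_lieBracketWithin]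
  have h : ∀ u : E, fderivWithin ℝ (fun _ : E => u) Set.univ y = 0 := by simp
  change fderivWithin ℝ (fun _ : E => w) Set.univ y v - fderivWithin ℝ (fun _ : E => v) Set.univ y w
    = (0 : E)
  rw [h, h, zero_apply, zero_apply, sub_zero]

theorem mlieBracket_constField [CompleteSpace E] {x₀ x : M} (hx : x ∈ (chartAt E x₀).source)
    (v w : E) : VectorField.mlieBracket 𝓘(ℝ, E) (constField x₀ v) (constField x₀ w) x = 0 := by
  have : IsManifold 𝓘(ℝ, E) (minSmoothness ℝ 2) M := by
    rw [minSmoothness_of_isRCLikeNormedField]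
    infer_instance
  rw [(constField_eventuallyEq_mpullback hx v).mlieBracket_vectorField_eq
    (constField_eventuallyEq_mpullback hx w)]
  have hc : ∀ (u : E) (y : E), MDifferentiableAt 𝓘(ℝ, E) 𝓘(ℝ, E).tangent
      (fun y => (⟨y, constVectorField u y⟩ : TangentBundle 𝓘(ℝ, E) E)) y := by
    intro u y
    rw [mdifferentiableAt_totalSpace]
    exact ⟨mdifferentiableAt_id, by simpa [constVectorField] using mdifferentiableAt_const⟩
  have hn : minSmoothness ℝ 2 ≤ ∞ := by
    rw [minSmoothness_of_isRCLikeNormedField]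
    exact WithTop.coe_le_coe.2 le_top
  rw [← VectorField.mpullback_mlieBracket (n := ∞) (hc v _) (hc w _)
    (contMDiffAt_extChartAt' hx) hn, VectorField.mpullback_apply, mlieBracket_constVectorField,
    map_zero]

variable [FiniteDimensional ℝ E]

/-- The coordinate expression at `x` of a metric in the chart at `x₀`. -/
def metricAt (g : RiemMetric E M) (x₀ x : M) : E →L[ℝ] E →L[ℝ] ℝ :=
  (LinearMap.mk₂ ℝ (fun v w => g.inner x (trInv x₀ x v) (trInv x₀ x w))
    (fun v v' w => by simp only [map_add, add_apply])
    (fun c v w => by simp only [map_smul, smul_apply])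
    (fun v w w' => by simp only [map_add])
    (fun c v w => by simp only [map_smul])).toContinuousBilinearMap

/-- The coordinate expression of a metric in the chart at `x₀`. -/
def coordMetric (g : RiemMetric E M) (x₀ : M) (y : E) : E →L[ℝ] E →L[ℝ] ℝ :=
  metricAt g x₀ ((extChartAt 𝓘(ℝ, E) x₀).symm y)

theorem metricAt_apply (g : RiemMetric E M) (x₀ x : M) (v w : E) :
    metricAt g x₀ x v w = g.inner x (trInv x₀ x v) (trInv x₀ x w) := rfl

theorem metricAt_tr (g : RiemMetric E M) {x₀ x : M} (hx : x ∈ (chartAt E x₀).source)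
    (X Y : TangentSpace 𝓘(ℝ, E) x) :
    metricAt g x₀ x (tr x₀ x X) (tr x₀ x Y) = g.inner x X Y := by
  rw [metricAt_apply, trInv_tr hx, trInv_tr hx]

theorem coordMetric_extChartAt (g : RiemMetric E M) {x₀ x : M} (hx : x ∈ (chartAt E x₀).source) :
    coordMetric g x₀ (extChartAt 𝓘(ℝ, E) x₀ x) = metricAt g x₀ x := by
  have hx' : x ∈ (extChartAt 𝓘(ℝ, E) x₀).source := by rwa [extChartAt_source]
  rw [coordMetric, (extChartAt 𝓘(ℝ, E) x₀).left_inv hx']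

theorem isMetricForm_metricAt (g : RiemMetric E M) {x₀ x : M} (hx : x ∈ (chartAt E x₀).source) :
    IsMetricForm (metricAt g x₀ x) where
  symm v w := g.symm _ _ _
  pos v hv := by
    refine g.pos _ _ fun h => hv ?_
    rw [← tr_trInv hx v, h, map_zero]

theorem isMetricForm_coordMetric (g : RiemMetric E M) (x₀ : M) :
    ∀ y ∈ (extChartAt 𝓘(ℝ, E) x₀).target, IsMetricForm (coordMetric g x₀ y) :=
  fun _ hy => isMetricForm_metricAt g (extChartAt_symm_mem hy)

theorem contMDiffAt_metricAt (g : RiemMetric E M) {x₀ x : M} (hx : x ∈ (chartAt E x₀).source)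
    (v w : E) : ContMDiffAt 𝓘(ℝ, E) 𝓘(ℝ, ℝ) ∞ (fun x => metricAt g x₀ x v w) x := by
  have h : ContMDiffAt 𝓘(ℝ, E) (𝓘(ℝ, E).prod 𝓘(ℝ, ℝ)) ∞
      (fun z => TotalSpace.mk' ℝ (E := Bundle.Trivial M ℝ) z
        (g.inner z (constField x₀ v z) (constField x₀ w z))) x :=
    ContMDiffAt.clm_bundle_apply₂ (F₁ := E) (F₂ := E) (g.contMDiff x)
      (contMDiffAt_constField hx v) (contMDiffAt_constField hx w)
  exact (contMDiffAt_totalSpace.1 h).2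

theorem contDiffOn_coordMetric (g : RiemMetric E M) (x₀ : M) :
    ContDiffOn ℝ ∞ (coordMetric g x₀) (extChartAt 𝓘(ℝ, E) x₀).target := by
  refine contDiffOn_clm_apply.2 fun v => contDiffOn_clm_apply.2 fun w => ?_
  rw [← contMDiffOn_iff_contDiffOn]
  intro y hy
  exact ContMDiffAt.comp_contMDiffWithinAt y
    (contMDiffAt_metricAt g (extChartAt_symm_mem hy) v w) (contMDiffOn_extChartAt_symm x₀ y hy)

/-- On coordinate fields the bracket term of the torsion vanishes, leaving the antisymmetric part of
the symbol. -/
theorem tr_torsion (D : LinearConnection E M) {x₀ x : M} (hx : x ∈ (chartAt E x₀).source)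
    (u v : E) : tr x₀ x (D.torsion x (trInv x₀ x u) (trInv x₀ x v)) =
      connSymbol D x₀ x u v - connSymbol D x₀ x v u := by
  have h := CovariantDerivative.torsion_apply D (mdifferentiableAt_constField hx u)
    (mdifferentiableAt_constField hx v)
  rw [mlieBracket_constField hx, sub_zero] at h
  refine (congrArg (tr x₀ x) h).trans ?_
  rw [map_sub, tr_connection_constField D hx, tr_connection_constField D hx, constField,
    constField, tr_trInv hx, tr_trInv hx]

theorem mvfderiv_metricAt (g : RiemMetric E M) {x₀ x : M} (hx : x ∈ (chartAt E x₀).source)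
    (u v w : E) : mvfderiv 𝓘(ℝ, E) (fun x => metricAt g x₀ x v w) x (trInv x₀ x u) =
      fderiv ℝ (coordMetric g x₀) (extChartAt 𝓘(ℝ, E) x₀ x) u v w := by
  have hx' : x ∈ (extChartAt 𝓘(ℝ, E) x₀).source := by rwa [extChartAt_source]
  have hm := (extChartAt 𝓘(ℝ, E) x₀).map_source hx'
  obtain ⟨h1, h2⟩ := hasMFDerivAt_of_coord hx
    ((contMDiffAt_metricAt g hx v w).mdifferentiableAt (by simp))
  have hd : DifferentiableAt ℝ (coordMetric g x₀) (extChartAt 𝓘(ℝ, E) x₀ x) :=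
    ((contDiffOn_coordMetric g x₀).contDiffAt
      ((isOpen_extChartAt_target x₀).mem_nhds hm)).differentiableAt (by simp)
  have h3 : fderiv ℝ ((fun x => metricAt g x₀ x v w) ∘ (extChartAt 𝓘(ℝ, E) x₀).symm)
      (extChartAt 𝓘(ℝ, E) x₀ x) u =
      fderiv ℝ (coordMetric g x₀) (extChartAt 𝓘(ℝ, E) x₀ x) u v w := by
    have h := (hd.hasFDerivAt.clm_apply (hasFDerivAt_const v _)).clm_apply (hasFDerivAt_const w _)
    refine (congrArg (fun f => f u) h.fderiv).trans ?_
    simp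
  rw [← h3, mvfderiv, h2.mfderiv]
  exact congrArg (fderiv ℝ ((fun x => metricAt g x₀ x v w) ∘ (extChartAt 𝓘(ℝ, E) x₀).symm)
      (extChartAt 𝓘(ℝ, E) x₀ x)) (tr_trInv hx u)

theorem derivMetricTensor_trInv (g : RiemMetric E M) (D : LinearConnection E M) {x₀ x : M}
    (hx : x ∈ (chartAt E x₀).source) (u v w : E) :
    letI : RiemannianBundle (fun x : M => TangentSpace 𝓘(ℝ, E) x) := ⟨g.toRiemannianMetric⟩
    CovariantDerivative.derivMetricTensor (F := E) (V := fun x : M => TangentSpace 𝓘(ℝ, E) x) D x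
      (trInv x₀ x v) (trInv x₀ x w) (trInv x₀ x u) =
      fderiv ℝ (coordMetric g x₀) (extChartAt 𝓘(ℝ, E) x₀ x) u v w -
        metricAt g x₀ x (connSymbol D x₀ x u v) w - metricAt g x₀ x v (connSymbol D x₀ x u w) := by
  let : RiemannianBundle (fun x : M => TangentSpace 𝓘(ℝ, E) x) := ⟨g.toRiemannianMetric⟩
  have h := CovariantDerivative.derivMetricTensor_apply (F := E)
    (V := fun x : M => TangentSpace 𝓘(ℝ, E) x) D x (X := constField x₀ u)
    (mdifferentiableAt_constField hx v) (mdifferentiableAt_constField hx w)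
  refine h.trans ?_
  have h1 : ∀ z, connSymbol D x₀ x u z = tr x₀ x (D (constField x₀ z) x (constField x₀ u x)) := by
    intro z
    rw [tr_connection_constField D hx, constField, tr_trInv hx]
  rw [h1, h1, ← mvfderiv_metricAt g hx]
  have h2 : ∀ (X : TangentSpace 𝓘(ℝ, E) x) (z : E), metricAt g x₀ x (tr x₀ x X) z =
      g.inner x X (constField x₀ z x) := by
    intro X z
    rw [← metricAt_tr g hx, constField, tr_trInv hx]
  rw [(isMetricForm_metricAt g hx).symm v, h2, h2, g.symm x _ (constField x₀ v x)]
  rfl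

/-- The Levi-Civita Christoffel symbol of a metric at `x` in the chart at `x₀`. -/
def metricSymbol (g : RiemMetric E M) (x₀ : M) (y : E) : E →L[ℝ] E →L[ℝ] E :=
  christoffel (coordMetric g x₀ y) (fderiv ℝ (coordMetric g x₀) y)

theorem IsLeviCivita.connSymbol_symm {g : RiemMetric E M} {D : LinearConnection E M}
    (hD : IsLeviCivita g D) {x₀ x : M} (hx : x ∈ (chartAt E x₀).source) (u v : E) :
    connSymbol D x₀ x u v = connSymbol D x₀ x v u := by
  rw [← sub_eq_zero, ← tr_torsion D hx, hD.1]
  exact map_zero (tr x₀ x)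

theorem IsLeviCivita.fderiv_coordMetric {g : RiemMetric E M} {D : LinearConnection E M}
    (hD : IsLeviCivita g D) {x₀ x : M} (hx : x ∈ (chartAt E x₀).source) (u v w : E) :
    fderiv ℝ (coordMetric g x₀) (extChartAt 𝓘(ℝ, E) x₀ x) u v w =
      metricAt g x₀ x (connSymbol D x₀ x u v) w + metricAt g x₀ x v (connSymbol D x₀ x u w) := by
  have h := derivMetricTensor_trInv g D hx u v w
  rw [hD.2] at h
  change 0 = _ at h
  linarith

/-- Holding at every point of one fixed chart, this identifies the symbol of the connection with the
Koszul expression, which depends smoothly on the point. -/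
theorem IsLeviCivita.connSymbol_eq {g : RiemMetric E M} {D : LinearConnection E M}
    (hD : IsLeviCivita g D) {x₀ x : M} (hx : x ∈ (chartAt E x₀).source) :
    connSymbol D x₀ x = metricSymbol g x₀ (extChartAt 𝓘(ℝ, E) x₀ x) := by
  rw [metricSymbol, coordMetric_extChartAt g hx]
  exact (isMetricForm_metricAt g hx).eq_christoffel (hD.connSymbol_symm hx)
    (hD.fderiv_coordMetric hx)

theorem fderiv_coordMetric_symm (g : RiemMetric E M) {x₀ : M} {y : E}
    (hy : y ∈ (extChartAt 𝓘(ℝ, E) x₀).target) (u v w : E) :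
    fderiv ℝ (coordMetric g x₀) y u v w = fderiv ℝ (coordMetric g x₀) y u w v := by
  have hx := extChartAt_symm_mem hy
  rw [← (extChartAt 𝓘(ℝ, E) x₀).right_inv hy, ← mvfderiv_metricAt g hx, ← mvfderiv_metricAt g hx]
  have h : (fun x => metricAt g x₀ x v w) = fun x => metricAt g x₀ x w v :=
    funext fun x => g.symm x _ _
  rw [h]

/-- The covariant derivative of a vector field for the Levi-Civita connection of a metric, computed
at each point in the chart at this point. -/
def leviCivitaFun (g : RiemMetric E M) (σ : Π x : M, TangentSpace 𝓘(ℝ, E) x) (x : M) :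
    TangentSpace 𝓘(ℝ, E) x →L[ℝ] TangentSpace 𝓘(ℝ, E) x :=
  flatConnection x σ x +
    trInv x x ∘L (metricSymbol g x (extChartAt 𝓘(ℝ, E) x x)).flip (tr x x (σ x)) ∘L tr x x

/-- The Levi-Civita connection of a metric. -/
def leviCivita (g : RiemMetric E M) : LinearConnection E M where
  toFun := leviCivitaFun g
  isCovariantDerivativeOnUniv :=
    { add := fun {σ σ' x} hσ hσ' _ => by
        have h := (isCovariantDerivativeOn_flatConnection x).add hσ hσ' (mem_chart_source E x)
        have h' : tr x x ((σ + σ') x) = tr x x (σ x) + tr x x (σ' x) := map_add _ _ _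
        rw [leviCivitaFun, h, h']
        ext X
        simp only [leviCivitaFun, add_apply, map_add, ContinuousLinearMap.comp_apply]
        abel
      leibniz := fun {σ f x} hσ hf _ => by
        have h := (isCovariantDerivativeOn_flatConnection x).leibniz hσ hf (mem_chart_source E x)
        have h' : tr x x ((f • σ) x) = f x • tr x x (σ x) := map_smul _ _ _
        rw [leviCivitaFun, h, h']
        ext X
        simp only [leviCivitaFun, add_apply, map_smul, smul_apply, smul_add,
          ContinuousLinearMap.comp_apply]
        abel }

theorem connSymbol_leviCivita (g : RiemMetric E M) (x : M) :
    connSymbol (leviCivita g) x x = metricSymbol g x (extChartAt 𝓘(ℝ, E) x x) := by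
  have hx := mem_chart_source E x
  ext u v
  have h1 := tr_connection_constField (leviCivita g) hx v (trInv x x u)
  rw [tr_trInv hx] at h1
  rw [← h1]
  have h2 : tr x x (constField x v x) = v := tr_trInv hx v
  have h3 : leviCivita g (constField x v) x (trInv x x u) =
      trInv x x (fderiv ℝ (coordField x (constField x v)) (extChartAt 𝓘(ℝ, E) x x)
        (tr x x (trInv x x u))) +
      trInv x x (metricSymbol g x (extChartAt 𝓘(ℝ, E) x x) (tr x x (trInv x x u))
        (tr x x (constField x v x))) := rfl
  rw [h3, h2, tr_trInv hx, (coordField_constField_eventuallyEq hx v).fderiv_eq, fderiv_const_apply,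
    zero_apply, map_zero, zero_add, tr_trInv hx]

/-- Torsion and $\nabla g$ are tensors, so they can be tested at each $x$ in the preferred chart at
$x$, where the symbol is the Koszul one by construction. No compatibility between different charts
has to be checked. -/
theorem isLeviCivita_leviCivita (g : RiemMetric E M) : IsLeviCivita g (leviCivita g) := by
  have hβ := fun x : M => isMetricForm_metricAt g (mem_chart_source E x)
  have hs := fun x : M => fderiv_coordMetric_symm g (mem_extChartAt_target (I := 𝓘(ℝ, E)) x)
  have hΓ : ∀ x : M, connSymbol (leviCivita g) x x =
      christoffel (metricAt g x x) (fderiv ℝ (coordMetric g x) (extChartAt 𝓘(ℝ, E) x x)) := by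
    intro x
    rw [connSymbol_leviCivita, metricSymbol, coordMetric_extChartAt g (mem_chart_source E x)]
  constructor
  · funext x
    have hx := mem_chart_source E x
    refine ContinuousLinearMap.ext fun X => ContinuousLinearMap.ext fun Y => ?_
    have h := tr_torsion (leviCivita g) hx (tr x x X) (tr x x Y)
    rw [hΓ, (hβ x).christoffel_symm (hs x), sub_self, trInv_tr hx, trInv_tr hx] at h
    refine (trInv_tr hx _).symm.trans ?_
    rw [h, map_zero]
    rfl
  · funext x
    have hx := mem_chart_source E x
    refine ContinuousLinearMap.ext fun Y => ContinuousLinearMap.ext fun Z =>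
      ContinuousLinearMap.ext fun X => ?_
    have h := derivMetricTensor_trInv g (leviCivita g) hx (tr x x X) (tr x x Y) (tr x x Z)
    rw [hΓ, trInv_tr hx, trInv_tr hx, trInv_tr hx, (hβ x).christoffel_metric (hs x)] at h
    refine h.trans ?_
    rw [add_sub_cancel_left, sub_self]
    rfl

end LeviCivita

/-! ### The bundle of isometric complex structures -/

section Isometric

open Filter Topology

variable {E : Type*} [NormedAddCommGroup E] [NormedSpace ℝ E]
  {M : Type*} [TopologicalSpace M] [ChartedSpace E M] [IsManifold 𝓘(ℝ, E) ∞ M]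
  {c : ConformalStructure E M} {g g' : RiemMetric E M}

theorem ConformalStructure.IsCompatible.conformallyRelated (hg : c.IsCompatible g)
    (hg' : c.IsCompatible g') : ConformallyRelated g g' :=
  Quotient.exact (hg.trans hg'.symm)

theorem ConformalStructure.exists_isCompatible (c : ConformalStructure E M) :
    ∃ g, c.IsCompatible g :=
  Quotient.exists_rep c

/-- The factor $e^{2\varphi}$ cancels from both sides of the isometry condition, so any one metric
of the class decides membership. -/
theorem mem_isometricComplexStructures_iff (hg : c.IsCompatible g) {J : EndBundle E M} :
    J ∈ isometricComplexStructures c ↔ J ∈ complexStructures E M ∧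
      ∀ X Y : TangentSpace 𝓘(ℝ, E) J.1, g.inner J.1 (J.2 X) (J.2 Y) = g.inner J.1 X Y := by
  refine and_congr_right fun _ => ⟨?_, fun h => ⟨g, hg, h⟩⟩
  rintro ⟨g', hg', h⟩ X Y
  obtain ⟨φ, -, hφ⟩ := hg.conformallyRelated hg'
  have h1 := h X Y
  rw [hφ, hφ] at h1
  exact mul_left_cancel₀ (Real.exp_ne_zero _) h1

variable [FiniteDimensional ℝ E]

theorem mem_isometricComplexStructures_iff_trEnd (hg : c.IsCompatible g) {x₀ : M}
    {J : EndBundle E M} (hx : J.1 ∈ (chartAt E x₀).source) :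
    J ∈ isometricComplexStructures c ↔
      IsIsometricComplex (metricAt g x₀ J.1) (trEnd x₀ J.1 J.2) := by
  rw [mem_isometricComplexStructures_iff hg]
  refine and_congr ?_ ?_
  · rw [← trEnd_comp hx]
    constructor
    · intro h
      ext v
      rw [trEnd_apply]
      have h1 : (J.2 ∘L J.2) (trInv x₀ J.1 v) = -trInv x₀ J.1 v := h _
      rw [h1, map_neg, tr_trInv hx]
      rfl
    · intro h X
      have h1 := congrArg (fun f => trInv x₀ J.1 (f (tr x₀ J.1 X))) h
      have h2 : trInv x₀ J.1 (trEnd x₀ J.1 (J.2 ∘L J.2) (tr x₀ J.1 X)) =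
          trInv x₀ J.1 (-(tr x₀ J.1 X)) := h1
      rw [trEnd_tr hx, trInv_tr hx, map_neg, trInv_tr hx] at h2
      exact h2
  · constructor
    · intro h v w
      rw [trEnd_apply, trEnd_apply, metricAt_tr g hx, h, metricAt_apply]
    · intro h X Y
      have h1 := h (tr x₀ J.1 X) (tr x₀ J.1 Y)
      rwa [trEnd_tr hx, trEnd_tr hx, metricAt_tr g hx, metricAt_tr g hx] at h1

theorem mem_isometricComplexStructures_iff_extChartAt (hg : c.IsCompatible g)
    {q₀ J : EndBundle E M} (hx : J.1 ∈ (chartAt E q₀.1).source) :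
    J ∈ isometricComplexStructures c ↔ extChartAt (endModel E) q₀ J ∈
      isometricSet (extChartAt 𝓘(ℝ, E) q₀.1).target (coordMetric g q₀.1) := by
  have hx' : J.1 ∈ (extChartAt 𝓘(ℝ, E) q₀.1).source := by rwa [extChartAt_source]
  rw [mem_isometricComplexStructures_iff_trEnd hg hx, extChartAt_endBundle]
  change _ ↔ _ ∧ IsIsometricComplex (coordMetric g q₀.1 (extChartAt 𝓘(ℝ, E) q₀.1 J.1)) _
  rw [coordMetric_extChartAt g hx, and_iff_right ((extChartAt 𝓘(ℝ, E) q₀.1).map_source hx')]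

/-- The straightening map is the chart of $\mathrm{End}(TM)$ at $p$ followed by the frame and Cayley
flattening. -/
theorem isEmbeddedSubmanifold_isometricComplexStructures (c : ConformalStructure E M) :
    IsEmbeddedSubmanifold (endModel E) (isometricComplexStructures c) := by
  intro p hp
  obtain ⟨g, hg⟩ := c.exists_isCompatible
  have hps := mem_chart_source E p.1
  have hp' := (mem_isometricComplexStructures_iff_extChartAt (q₀ := p) hg hps).1 hp
  obtain ⟨V, P, Q, hVo, hyV, hVU, hP, hQ, hP0, hPQ⟩ := exists_frame (isOpen_extChartAt_target p.1)
    (isMetricForm_coordMetric g p.1) (contDiffOn_coordMetric g p.1) hp'.1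
  obtain ⟨φ, hφp, hφV, hφ, hφ', -, -, hφi⟩ :=
    exists_flattening (U := (extChartAt 𝓘(ℝ, E) p.1).target) hVo hyV hVU hP hQ hP0 hPQ hp'.2
  let e : OpenPartialHomeomorph (EndBundle E M) (E × (E →L[ℝ] E)) :=
    chartAt (ModelProd E (E →L[ℝ] E)) p
  have he : ContMDiffOn (endModel E) 𝓘(ℝ, E × (E →L[ℝ] E)) ∞ e e.source :=
    contMDiffOn_extChartAt (I := endModel E) (x := p)
  have het : (extChartAt (endModel E) p).target = e.target := extChartAt_endBundle_target p
  have he' : ContMDiffOn 𝓘(ℝ, E × (E →L[ℝ] E)) (endModel E) ∞ e.symm e.target := by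
    rw [← het]
    exact contMDiffOn_extChartAt_symm (I := endModel E) p
  refine ⟨Submodule.prod ⊤ (anticommEnd (extChartAt (endModel E) p p).2 ⊓
    skewEnd (coordMetric g p.1 (extChartAt (endModel E) p p).1)), e.trans φ, ?_, ?_, ?_,
    fun q hq => ?_⟩
  · exact ⟨chart_endBundle_source.2 hps, hφp⟩
  · rw [OpenPartialHomeomorph.trans_source]
    exact hφ.contMDiffOn.comp (he.mono Set.inter_subset_left) fun q hq => hq.2
  · rw [OpenPartialHomeomorph.trans_target]
    exact he'.comp (hφ'.contMDiffOn.mono Set.inter_subset_left) fun q hq => hq.2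
  · exact (mem_isometricComplexStructures_iff_extChartAt hg (chart_endBundle_source.1 hq.1)).trans
      (hφi _ hq.2)

/-- Leibniz rule for $e^{2\varphi}g$; $\theta$ is $d\varphi$ read in the chart. -/
theorem fderiv_coordMetric_conformal {φ : M → ℝ} (hφ : ContMDiff 𝓘(ℝ, E) 𝓘(ℝ, ℝ) ∞ φ)
    (h : ∀ (x : M) (X Y : TangentSpace 𝓘(ℝ, E) x),
      g'.inner x X Y = Real.exp (2 * φ x) * g.inner x X Y)
    {x₀ x : M} (hx : x ∈ (chartAt E x₀).source) : ∃ θ : E →L[ℝ] ℝ, ∀ u v w,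
      fderiv ℝ (coordMetric g' x₀) (extChartAt 𝓘(ℝ, E) x₀ x) u v w =
        Real.exp (2 * φ x) * (2 * θ u * metricAt g x₀ x v w +
          fderiv ℝ (coordMetric g x₀) (extChartAt 𝓘(ℝ, E) x₀ x) u v w) := by
  have hx' : x ∈ (extChartAt 𝓘(ℝ, E) x₀).source := by rwa [extChartAt_source]
  have hm := (extChartAt 𝓘(ℝ, E) x₀).map_source hx'
  have h1 := (hasMFDerivAt_of_coord hx (hφ.mdifferentiable (by simp) x)).1
  have hd : DifferentiableAt ℝ (coordMetric g x₀) (extChartAt 𝓘(ℝ, E) x₀ x) :=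
    ((contDiffOn_coordMetric g x₀).contDiffAt
      ((isOpen_extChartAt_target x₀).mem_nhds hm)).differentiableAt (by simp)
  have he : coordMetric g' x₀ = fun y =>
      Real.exp (2 * (φ ∘ (extChartAt 𝓘(ℝ, E) x₀).symm) y) • coordMetric g x₀ y := by
    funext y
    ext v w
    exact h _ _ _
  have h2 := ((h1.hasFDerivAt.const_mul 2).exp).fun_smul hd.hasFDerivAt
  refine ⟨fderiv ℝ (φ ∘ (extChartAt 𝓘(ℝ, E) x₀).symm) (extChartAt 𝓘(ℝ, E) x₀ x), fun u v w => ?_⟩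
  rw [he, h2.fderiv]
  simp only [add_apply, smul_apply, ContinuousLinearMap.smulRight_apply, smul_eq_mul,
    coordMetric_extChartAt g hx, Function.comp_apply, (extChartAt 𝓘(ℝ, E) x₀).left_inv hx']
  ring

/-- The natural almost complex structures associated to the Levi-Civita connections of conformally
related metrics coincide at the isometric complex structures. -/
theorem naturalComplexStructure_eq (hg : c.IsCompatible g) (hg' : c.IsCompatible g')
    {D D' : LinearConnection E M} (hD : IsLeviCivita g D) (hD' : IsLeviCivita g' D')
    {J : EndBundle E M} (hJ : J ∈ isometricComplexStructures c) :
    naturalComplexStructure D J = naturalComplexStructure D' J := by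
  have hx := mem_chart_source E J.1
  have ha := (mem_isometricComplexStructures_iff_trEnd hg hx).1 hJ
  have hβ := isMetricForm_metricAt g hx
  obtain ⟨φ, hφ, h⟩ := hg.conformallyRelated hg'
  obtain ⟨θ, hθ⟩ := fderiv_coordMetric_conformal hφ h hx
  have hm : ∀ v w, metricAt g' J.1 J.1 v w = Real.exp (2 * φ J.1) * metricAt g J.1 J.1 v w :=
    fun v w => h _ _ _
  refine LinearMap.ext fun w => trN_injective hx ?_
  rw [trN_naturalComplexStructure D hx, trN_naturalComplexStructure D' hx,
    modelJ_eq_of_conformal hβ.symm hβ.eq_zero (hD.connSymbol_symm hx) (hD'.connSymbol_symm hx) θ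
      (fun u v w => ?_) ha]
  have h1 := hθ u v w
  -- Metric compatibility replaces both derivatives by symbols; dividing by $e^{2\varphi}$ gives the
  -- relation on $\Gamma'-\Gamma$ that `modelJ_eq_of_conformal` requires.
  rw [hD.fderiv_coordMetric hx, hD'.fderiv_coordMetric hx, hm, hm, ← mul_add] at h1
  have h2 := mul_left_cancel₀ (Real.exp_ne_zero _) h1
  simp only [sub_apply, map_sub]
  linear_combination h2

end Isometric

/-! ### The tangent spaces and the almost complex structure of the bundle of isometric complex
structures -/

section Tangent

open Filter Topology

variable {E : Type*} [NormedAddCommGroup E] [NormedSpace ℝ E]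
  {M : Type*} [TopologicalSpace M] [ChartedSpace E M] [IsManifold 𝓘(ℝ, E) ∞ M]

theorem endBundle_tangent_ext {q₀ p q : EndBundle E M} {v : TangentSpace (endModel E) p}
    {w : TangentSpace (endModel E) q} (hpq : p = q) (hq : q.1 ∈ (chartAt E q₀.1).source)
    (h : trN q₀ p v = trN q₀ q w) :
    (⟨p, v⟩ : TangentBundle (endModel E) (EndBundle E M)) = ⟨q, w⟩ := by
  subst hpq
  rw [trN_injective hq h]

theorem hasDerivAt_extChartAt_comp {q₀ : EndBundle E M} {γ : ℝ → EndBundle E M}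
    (hγ : MDifferentiableAt 𝓘(ℝ, ℝ) (endModel E) γ 0) (hq : (γ 0).1 ∈ (chartAt E q₀.1).source) :
    HasDerivAt (fun t => extChartAt (endModel E) q₀ (γ t))
      (trN q₀ (γ 0) (mfderiv 𝓘(ℝ, ℝ) (endModel E) γ 0 (1 : ℝ))) 0 := by
  let L : ℝ →L[ℝ] E × (E →L[ℝ] E) := trN q₀ (γ 0) ∘L mfderiv 𝓘(ℝ, ℝ) (endModel E) γ 0
  have h : HasMFDerivAt 𝓘(ℝ, ℝ) 𝓘(ℝ, E × (E →L[ℝ] E))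
      (fun t => extChartAt (endModel E) q₀ (γ t)) 0 L :=
    (hasMFDerivAt_extChartAt_trN hq).comp 0 hγ.hasMFDerivAt
  have h' : HasFDerivAt (fun t => extChartAt (endModel E) q₀ (γ t)) L 0 := h.hasFDerivAt
  exact h'.hasDerivAt

variable [FiniteDimensional ℝ E] {c : ConformalStructure E M} {g : RiemMetric E M}

theorem fderiv_coordMetric_metricSymbol (g : RiemMetric E M) {x₀ x : M}
    (hx : x ∈ (chartAt E x₀).source) (u v w : E) :
    fderiv ℝ (coordMetric g x₀) (extChartAt 𝓘(ℝ, E) x₀ x) u v w =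
      coordMetric g x₀ (extChartAt 𝓘(ℝ, E) x₀ x)
        (metricSymbol g x₀ (extChartAt 𝓘(ℝ, E) x₀ x) u v) w +
      coordMetric g x₀ (extChartAt 𝓘(ℝ, E) x₀ x) v
        (metricSymbol g x₀ (extChartAt 𝓘(ℝ, E) x₀ x) u w) := by
  have hD := isLeviCivita_leviCivita g
  rw [← hD.connSymbol_eq hx, coordMetric_extChartAt g hx]
  exact hD.fderiv_coordMetric hx u v w

theorem trN_velocity_mem_modelTangent (hg : c.IsCompatible g) {γ : ℝ → EndBundle E M}
    (hγ : MDifferentiableAt 𝓘(ℝ, ℝ) (endModel E) γ 0)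
    (hi : ∀ᶠ t in 𝓝 0, γ t ∈ isometricComplexStructures c) {q₀ : EndBundle E M}
    (hq : (γ 0).1 ∈ (chartAt E q₀.1).source) :
    trN q₀ (γ 0) (mfderiv 𝓘(ℝ, ℝ) (endModel E) γ 0 (1 : ℝ)) ∈
      modelTangent (metricAt g q₀.1 (γ 0).1)
        (metricSymbol g q₀.1 (extChartAt 𝓘(ℝ, E) q₀.1 (γ 0).1)) (trEnd q₀.1 (γ 0).1 (γ 0).2) := by
  have hd := hasDerivAt_extChartAt_comp hγ hq
  have hs : ∀ᶠ t in 𝓝 0, γ t ∈ (chartAt (ModelProd E (E →L[ℝ] E)) q₀).source :=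
    hγ.continuousAt.eventually
      ((chartAt _ q₀).open_source.mem_nhds (chart_endBundle_source.2 hq))
  have h0 : extChartAt (endModel E) q₀ (γ 0) =
    (extChartAt 𝓘(ℝ, E) q₀.1 (γ 0).1, trEnd q₀.1 (γ 0).1 (γ 0).2) := extChartAt_endBundle _ _
  have hq' : (γ 0).1 ∈ (extChartAt 𝓘(ℝ, E) q₀.1).source := by rwa [extChartAt_source]
  have hm := (extChartAt 𝓘(ℝ, E) q₀.1).map_source hq'
  have h := velocity_mem_modelTangent (β := coordMetric g q₀.1) hd
    (Γ := metricSymbol g q₀.1 (extChartAt 𝓘(ℝ, E) q₀.1 (γ 0).1)) ?_ ?_ ?_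
  · simp only [h0, coordMetric_extChartAt g hq] at h
    exact h
  · rw [h0]
    exact ((contDiffOn_coordMetric g q₀.1).contDiffAt
      ((isOpen_extChartAt_target q₀.1).mem_nhds hm)).differentiableAt (by simp)
  · filter_upwards [hi, hs] with t ht hts
    exact ((mem_isometricComplexStructures_iff_extChartAt hg (chart_endBundle_source.1 hts)).1 ht).2
  · rw [h0]
    exact fderiv_coordMetric_metricSymbol g hq

theorem tangentSubspace_le (hg : c.IsCompatible g) (q : EndBundle E M) :
    tangentSubspace (endModel E) (isometricComplexStructures c) q ≤
      (modelTangent (metricAt g q.1 q.1) (metricSymbol g q.1 (extChartAt 𝓘(ℝ, E) q.1 q.1))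
        (trEnd q.1 q.1 q.2)).comap (trN q q).toLinearMap := by
  refine Submodule.span_le.2 ?_
  rintro v ⟨ε, hε, γ, hγ, hi, h⟩
  have hI : Set.Ioo (-ε) ε ∈ 𝓝 (0 : ℝ) := Ioo_mem_nhds (neg_lt_zero.2 hε) hε
  have hγd := (hγ.contMDiffAt hI).mdifferentiableAt (by simp)
  obtain ⟨rfl, h⟩ := TotalSpace.mk.inj h
  have h := eq_of_heq h
  have h1 := trN_velocity_mem_modelTangent hg hγd (Filter.mem_of_superset hI hi)
    (mem_chart_source E (γ 0).1)
  rw [h] at h1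
  exact h1

/-- Every vector of the model subspace is already the velocity of a curve, so taking the span adds
nothing. -/
theorem mem_tangentSubspace_iff (hg : c.IsCompatible g) {q : EndBundle E M}
    (hq : q ∈ isometricComplexStructures c) (w : TangentSpace (endModel E) q) :
    w ∈ tangentSubspace (endModel E) (isometricComplexStructures c) q ↔
      trN q q w ∈ modelTangent (metricAt g q.1 q.1)
        (metricSymbol g q.1 (extChartAt 𝓘(ℝ, E) q.1 q.1)) (trEnd q.1 q.1 q.2) := by
  have hqs := mem_chart_source E q.1
  constructor
  · exact fun hw => tangentSubspace_le hg q hw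
  · intro hw
    have hqm := (mem_isometricComplexStructures_iff_extChartAt (q₀ := q) hg hqs).1 hq
    have hqm1 := hqm.1
    have hqm2 := hqm.2
    rw [extChartAt_endBundle] at hqm1 hqm2
    rw [← coordMetric_extChartAt g hqs] at hw
    obtain ⟨ε, hε, δ, hδ, hδ0, hδ', hi⟩ := exists_curve_of_mem_modelTangent
      (isOpen_extChartAt_target q.1) (isMetricForm_coordMetric g q.1)
      (contDiffOn_coordMetric g q.1) hqm1 (fderiv_coordMetric_metricSymbol g hqs) hqm2 hw
    have hI : Set.Ioo (-ε) ε ∈ 𝓝 (0 : ℝ) := Ioo_mem_nhds (neg_lt_zero.2 hε) hε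
    have ht : ∀ t ∈ Set.Ioo (-ε) ε, δ t ∈ (extChartAt (endModel E) q).target := by
      intro t ht
      rw [extChartAt_endBundle_target, chart_endBundle_target]
      have h := (hi t ht).1
      simpa only [mfld_simps] using h
    let γ : ℝ → EndBundle E M := fun t => (extChartAt (endModel E) q).symm (δ t)
    have hγ : ContMDiffOn 𝓘(ℝ, ℝ) (endModel E) ∞ γ (Set.Ioo (-ε) ε) :=
      (contMDiffOn_extChartAt_symm q).comp hδ.contMDiffOn ht
    have hγ0 : γ 0 = q := by
      have h : δ 0 = extChartAt (endModel E) q q := hδ0.trans (extChartAt_endBundle q q).symm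
      change (extChartAt (endModel E) q).symm (δ 0) = q
      rw [h, extChartAt_to_inv]
    have hγs : ∀ t ∈ Set.Ioo (-ε) ε, (γ t).1 ∈ (chartAt E q.1).source := by
      intro t ht'
      have h := (extChartAt (endModel E) q).map_target (ht t ht')
      rw [extChartAt_source] at h
      exact chart_endBundle_source.1 h
    have hγe : ∀ t ∈ Set.Ioo (-ε) ε, extChartAt (endModel E) q (γ t) = δ t :=
      fun t ht' => (extChartAt (endModel E) q).right_inv (ht t ht')
    refine Submodule.subset_span ⟨ε, hε, γ, hγ, fun t ht' => ?_, ?_⟩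
    · rw [mem_isometricComplexStructures_iff_extChartAt hg (hγs t ht'), hγe t ht']
      exact hi t ht'
    · refine endBundle_tangent_ext hγ0 hqs ?_
      have hγd := (hγ.contMDiffAt hI).mdifferentiableAt (by simp)
      have h1 := hasDerivAt_extChartAt_comp hγd (hγs 0 (mem_of_mem_nhds hI))
      exact h1.unique (hδ'.congr_of_eventuallyEq (Filter.mem_of_superset hI hγe))

theorem naturalComplexStructure_mem_tangentSubspace (hg : c.IsCompatible g)
    {D : LinearConnection E M} (hD : IsLeviCivita g D) {q : EndBundle E M}
    (hq : q ∈ isometricComplexStructures c) {w : TangentSpace (endModel E) q}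
    (hw : w ∈ tangentSubspace (endModel E) (isometricComplexStructures c) q) :
    naturalComplexStructure D q w ∈
      tangentSubspace (endModel E) (isometricComplexStructures c) q := by
  have hqs := mem_chart_source E q.1
  rw [mem_tangentSubspace_iff hg hq] at hw ⊢
  rw [trN_naturalComplexStructure D hqs, hD.connSymbol_eq hqs]
  exact modelJ_mem_modelTangent ((mem_isometricComplexStructures_iff_trEnd hg hqs).1 hq) hw

theorem naturalComplexStructure_sq (D : LinearConnection E M) {q : EndBundle E M}
    (hq : q ∈ complexStructures E M) (w : TangentSpace (endModel E) q) :
    naturalComplexStructure D q (naturalComplexStructure D q w) = -w := by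
  obtain ⟨⟨X, B⟩, rfl⟩ := (splitting D q).surjective w
  have h : q.2 ∘L (q.2 ∘L B) = -B := ContinuousLinearMap.ext fun v => hq _
  rw [splitting_apply, naturalComplexStructure_apply, naturalComplexStructure_apply, h, hq X,
    map_neg, map_neg, neg_add]

theorem contDiffOn_metricSymbol (g : RiemMetric E M) (x₀ : M) :
    ContDiffOn ℝ ∞ (metricSymbol g x₀) (extChartAt 𝓘(ℝ, E) x₀).target :=
  contDiffOn_christoffel (isOpen_extChartAt_target x₀) (isMetricForm_coordMetric g x₀)
    (contDiffOn_coordMetric g x₀)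

/-- `modelJ` as a continuous linear map. -/
def modelJL (Γ : E →L[ℝ] E →L[ℝ] E) (a : E →L[ℝ] E) :
    E × (E →L[ℝ] E) →L[ℝ] E × (E →L[ℝ] E) :=
  (modelJ Γ a).toContinuousLinearMap

/-- Applied to a fixed vector, the expression is polynomial in $(\Gamma,a)$. -/
theorem contDiff_modelJL : ContDiff ℝ ∞
    fun z : (E →L[ℝ] E →L[ℝ] E) × (E →L[ℝ] E) => modelJL z.1 z.2 := by
  refine contDiff_clm_apply_iff.2 fun w => ?_
  have ha : ContDiff ℝ ∞ fun z : (E →L[ℝ] E →L[ℝ] E) × (E →L[ℝ] E) => z.2 := contDiff_snd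
  have hΓ : ContDiff ℝ ∞ fun z : (E →L[ℝ] E →L[ℝ] E) × (E →L[ℝ] E) => z.1 := contDiff_fst
  have haw := ha.clm_apply (contDiff_const (c := w.1))
  have hv : ContDiff ℝ ∞
      fun z : (E →L[ℝ] E →L[ℝ] E) × (E →L[ℝ] E) => vertPart z.1 z.2 w := by
    have hΓw := hΓ.clm_apply (contDiff_const (c := w.1))
    exact contDiff_const.add ((hΓw.mul ha).sub (ha.mul hΓw))
  have hΓaw := hΓ.clm_apply haw
  exact haw.prodMk ((ha.mul hv).sub ((hΓaw.mul ha).sub (ha.mul hΓaw)))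

/-- The natural almost complex structure at a point, as a continuous linear map. -/
def naturalComplexStructureL (D : LinearConnection E M) (q : EndBundle E M) :
    TangentSpace (endModel E) q →L[ℝ] TangentSpace (endModel E) q :=
  let f : E × (E →L[ℝ] E) →ₗ[ℝ] E × (E →L[ℝ] E) := naturalComplexStructure D q
  f.toContinuousLinearMap

/-- In the chart at $p$ the field is `modelJL` evaluated at the Koszul symbol and the fibre
coordinate. It is smooth on all of $\mathrm{End}(TM)$, so it serves as a global smooth extension of
the structure on $H(TM)$. -/
theorem contMDiff_naturalComplexStructureL {D : LinearConnection E M} (hD : IsLeviCivita g D) :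
    ContMDiff (endModel E)
      ((endModel E).prod 𝓘(ℝ, E × (E →L[ℝ] E) →L[ℝ] E × (E →L[ℝ] E))) ∞
      (fun q : EndBundle E M => TotalSpace.mk' (E × (E →L[ℝ] E) →L[ℝ] E × (E →L[ℝ] E))
        (E := fun q : EndBundle E M =>
          TangentSpace (endModel E) q →L[ℝ] TangentSpace (endModel E) q)
        q (naturalComplexStructureL D q)) := by
  intro p
  have hp := mem_chart_source E p.1
  rw [contMDiffAt_hom_bundle]
  refine ⟨contMDiffAt_id, ?_⟩
  have hG : ContDiffOn ℝ ∞ (fun z : E × (E →L[ℝ] E) => modelJL (metricSymbol g p.1 z.1) z.2)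
      (Prod.fst ⁻¹' (extChartAt 𝓘(ℝ, E) p.1).target) :=
    contDiff_modelJL.comp_contDiffOn
      (((contDiffOn_metricSymbol g p.1).comp contDiff_fst.contDiffOn fun z hz => hz).prodMk
        contDiff_snd.contDiffOn)
  have hGp : ContDiffAt ℝ ∞ (fun z : E × (E →L[ℝ] E) => modelJL (metricSymbol g p.1 z.1) z.2)
      (extChartAt (endModel E) p p) := by
    refine hG.contDiffAt (((isOpen_extChartAt_target p.1).preimage continuous_fst).mem_nhds ?_)
    rw [extChartAt_endBundle]
    exact mem_extChartAt_target p.1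
  refine (hGp.contMDiffAt.comp p contMDiffAt_extChartAt).congr_of_eventuallyEq ?_
  filter_upwards [(chartAt _ p).open_source.mem_nhds (chart_endBundle_source.2 hp)] with q hq
  have hq' := chart_endBundle_source.1 hq
  refine ContinuousLinearMap.ext fun w => ?_
  have h := trN_naturalComplexStructure D hq' (trNInv p q w)
  rw [trN_trNInv hq', hD.connSymbol_eq hq'] at h
  have h' : (extChartAt (endModel E) p) q = _ := extChartAt_endBundle p q
  rw [Function.comp_apply, h']
  exact h

/-- The almost complex structure of the bundle of isometric complex structures, computed with a
metric and its Levi-Civita connection. -/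
def twistorStructure (hg : c.IsCompatible g) {D : LinearConnection E M} (hD : IsLeviCivita g D) :
    AlmostComplexStructureOn (endModel E) (isometricComplexStructures c) where
  toFun q := (naturalComplexStructure D q).restrict fun _ hw =>
    naturalComplexStructure_mem_tangentSubspace hg hD q.2 hw
  sq_eq_neg q v := Subtype.ext (naturalComplexStructure_sq D q.2.1 v)
  smooth _ := ⟨Set.univ, isOpen_univ, Set.mem_univ _, naturalComplexStructureL D,
    (contMDiff_naturalComplexStructureL hD).contMDiffOn, fun _ _ _ => rfl⟩

end Tangent

end ConformalTwistor

end

/-! ### The theorem. -/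

theorem mainTheorem8 {ℓ : ℕ} {E : Type*} [NormedAddCommGroup E] [NormedSpace ℝ E]
    [FiniteDimensional ℝ E] (hE : Module.finrank ℝ E = 2 * ℓ)
    {M : Type*} [TopologicalSpace M] [T2Space M] [SecondCountableTopology M]
    [ChartedSpace E M] [IsManifold 𝓘(ℝ, E) ∞ M]
    (c : ConformalStructure E M) :
    (∀ g g' : RiemMetric E M, c.IsCompatible g → c.IsCompatible g' →
      ∀ D D' : LinearConnection E M, IsLeviCivita g D → IsLeviCivita g' D' →
        ∀ J ∈ isometricComplexStructures c,
          ∀ v ∈ tangentSubspace (endModel E) (complexStructures E M) J,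
            naturalComplexStructure D J v = naturalComplexStructure D' J v) ∧
    IsEmbeddedSubmanifold (endModel E) (isometricComplexStructures c) ∧
    ∃! j : AlmostComplexStructureOn (endModel E) (isometricComplexStructures c),
      ∀ g : RiemMetric E M, c.IsCompatible g →
        ∀ D : LinearConnection E M, IsLeviCivita g D →
          ∀ (J : isometricComplexStructures c)
            (v : tangentSubspace (endModel E) (isometricComplexStructures c) (J : EndBundle E M)),
            (j.toFun J v : TangentSpace (endModel E) (J : EndBundle E M)) =
              naturalComplexStructure D J v := by
  have key : ∀ g g' : RiemMetric E M, c.IsCompatible g → c.IsCompatible g' →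
      ∀ D D' : LinearConnection E M, IsLeviCivita g D → IsLeviCivita g' D' →
        ∀ J ∈ isometricComplexStructures c,
          naturalComplexStructure D J = naturalComplexStructure D' J :=
    fun g g' hg hg' D D' hD hD' J hJ => naturalComplexStructure_eq hg hg' hD hD' hJ
  refine ⟨fun g g' hg hg' D D' hD hD' J hJ v _ => by rw [key g g' hg hg' D D' hD hD' J hJ],
    isEmbeddedSubmanifold_isometricComplexStructures c, ?_⟩
  obtain ⟨g, hg⟩ := c.exists_isCompatible
  have hD := isLeviCivita_leviCivita g
  refine ⟨twistorStructure hg hD, fun g' hg' D' hD' J v => ?_, ?_⟩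
  · rw [← key g g' hg hg' _ D' hD hD' J J.2]
    rfl
  · rintro ⟨f, hf, hs⟩ h
    -- One metric with its Levi-Civita connection already prescribes the endomorphisms; the
    -- remaining fields of the structure are propositions.
    have hfe : f = (twistorStructure hg hD).toFun :=
      funext fun J => LinearMap.ext fun v => Subtype.ext (h g hg _ hD J v)
    subst hfe
    rfl
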